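/- Let $N\ge 5$ and $2^{**}:=\frac{2N}{N-4}$. Let $V:(0,\infty)\to[0,+\infty]$ be measurable with $V\in L^1_{\mathrm{loc}}((0,\infty))$, and let $K:(0,\infty)\to(0,\infty)$ be measurable with $K\in L^s_{\mathrm{loc}}((0,\infty))$ for some $s>1$. Let $D^{2,2}(\mathbb{R}^N)$ be the space of functions $u\in L^{2^{**}}(\mathbb{R}^N)$ whose weak second derivatives belong to $L^2(\mathbb{R}^N)$, and let $H^2_{V,r}$ be the set of radial functions $u\in D^{2,2}(\mathbb{R}^N)$ such that $\int_{\mathbb{R}^N}V(|x|)|u|^2\,dx<\infty$, with the norm $$\|u\|:=\Big(\int_{\mathbb{R}^N}|\Delta u|^2+V(|x|)|u|^2\,dx\Big)^{1/2}.$$ For $q>1$ and $R>0$ define $$\mathcal{R}_\infty(q,R):=\sup_{u,h\in H^2_{V,r},\ \|u\|=\|h\|=1}\int_{\{|x|\ge R\}}K(|x|)\,|u|^{q-1}|h|\,dx\in[0,+\infty].$$ Theorem. Assume that there is $R_2>0$ such that $V(r)<+\infty$ for almost every $r>R_2$, $$\operatorname*{ess\,sup}_{r>R_2}\frac{K(r)}{r^{\alpha_\infty}V(r)^{\beta_\infty}}<+\infty\quad\text{for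 some }0\le\beta_\infty\le1\text{ and }\alpha_\infty\in\mathbb{R},$$ and $$\operatorname*{ess\,inf}_{r>R_2}\ r^{\gamma_\infty}V(r)>0\quad\text{for some }\gamma_\infty\le4.$$ Then $\lim_{R\to+\infty}\mathcal{R}_\infty(q_2,R)=0$ for all $q_2\in\mathbb{R}$ such that $q_2>\max\{1,2\beta_\infty,q_*,q_{**}\}$, where $$q_*=2\,\frac{\alpha_\infty-\gamma_\infty\beta_\infty+N}{N-\gamma_\infty},\qquad q_{**}=2\,\frac{2\alpha_\infty+(1-2\beta_\infty)\gamma_\infty+2(N-2)}{2(N-2)-\gamma_\infty}.$$ -/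

import Mathlib

open MeasureTheory Set Filter Topology
open scoped ENNReal

noncomputable section

namespace Bilaplacian

/-- The Euclidean space `ℝ^N`. -/
abbrev E (N : ℕ) : Type := EuclideanSpace ℝ (Fin N)

/-- The classical second partial derivative `∂ⱼ∂ᵢ φ (x)`. -/
def secondPartial {N : ℕ} (φ : E N → ℝ) (i j : Fin N) (x : E N) : ℝ :=
  fderiv ℝ (fun y => fderiv ℝ φ y (EuclideanSpace.single i 1)) x (EuclideanSpace.single j 1)

/-- `w` is the weak second partial derivative `∂ⱼ∂ᵢ u` on `ℝ^N`:
`∫ u ∂ⱼ∂ᵢφ = ∫ w φ` for all `φ ∈ C_c^∞(ℝ^N)`. -/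
def IsWeakSecondPartial {N : ℕ} (u : E N → ℝ) (i j : Fin N) (w : E N → ℝ) : Prop :=
  LocallyIntegrable u volume ∧ LocallyIntegrable w volume ∧
    ∀ φ : E N → ℝ, ContDiff ℝ (⊤ : ℕ∞) φ → HasCompactSupport φ →
      ∫ x, u x * secondPartial φ i j x = ∫ x, w x * φ x

/-- `D^{2,2}(ℝ^N)`: the functions in `L^{2N/(N-4)}` all of whose weak second partial derivatives
are in `L²`. -/
def MemD22 {N : ℕ} (u : E N → ℝ) : Prop :=
  MemLp u (ENNReal.ofReal (2 * (N : ℝ) / ((N : ℝ) - 4))) volume ∧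
    ∀ i j : Fin N, ∃ w : E N → ℝ, IsWeakSecondPartial u i j w ∧ MemLp w 2 volume

open Classical in
/-- A representative of the weak second partial derivative `∂ⱼ∂ᵢ u` (unique up to null sets),
for functions having one in `L²`; the value `0` for other functions is never used. -/
def weakSecondPartial {N : ℕ} (u : E N → ℝ) (i j : Fin N) : E N → ℝ :=
  if h : ∃ w : E N → ℝ, IsWeakSecondPartial u i j w ∧ MemLp w 2 volume then h.choose else 0

/-- The weak Laplacian `Δu = ∑ᵢ ∂ᵢ∂ᵢ u`. -/
def weakLaplacian {N : ℕ} (u : E N → ℝ) (x : E N) : ℝ :=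
  ∑ i : Fin N, weakSecondPartial u i i x

/-- `u(x) = u(|x|)`, as an identity between functions modulo null sets. -/
def IsRadial {N : ℕ} (u : E N → ℝ) : Prop :=
  ∃ g : ℝ → ℝ, ∀ᵐ x : E N ∂volume, u x = g ‖x‖

/-- `H²_V(ℝ^N)`: the functions in `D^{2,2}(ℝ^N)` with `∫ V(|x|) |u|² dx < ∞`. -/
def MemH2 {N : ℕ} (V : ℝ → ℝ≥0∞) (u : E N → ℝ) : Prop :=
  MemD22 u ∧ ∫⁻ x, V ‖x‖ * ‖u x‖ₑ ^ 2 < ∞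

/-- `H²_{V,r}(ℝ^N)`: the radial functions in `H²_V(ℝ^N)`. -/
def MemH2Rad {N : ℕ} (V : ℝ → ℝ≥0∞) (u : E N → ℝ) : Prop :=
  MemH2 V u ∧ IsRadial u

/-- The norm `‖u‖ = (∫ |Δu|² + V(|x|) |u|² dx)^{1/2}` of `H²_V(ℝ^N)`. -/
def normH2 {N : ℕ} (V : ℝ → ℝ≥0∞) (u : E N → ℝ) : ℝ≥0∞ :=
  (∫⁻ x, (‖weakLaplacian u x‖ₑ ^ 2 + V ‖x‖ * ‖u x‖ₑ ^ 2)) ^ (1 / 2 : ℝ)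

/-- `R_∞(q, R)`: the supremum of `∫_{ℝ^N ∖ B_R} K(|x|) |u|^{q-1} |h| dx` over all
`u, h ∈ H²_{V,r}` with `‖u‖ = ‖h‖ = 1`, as an element of `[0, ∞]`. -/
def RInf (N : ℕ) (V : ℝ → ℝ≥0∞) (K : ℝ → ℝ) (q R : ℝ) : ℝ≥0∞ :=
  ⨆ (u : E N → ℝ) (h : E N → ℝ) (_ : MemH2Rad V u) (_ : MemH2Rad V h)
    (_ : normH2 V u = 1) (_ : normH2 V h = 1),
    ∫⁻ x in (Metric.ball (0 : E N) R)ᶜ, ENNReal.ofReal (K ‖x‖ * |u x| ^ (q - 1) * |h x|)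

/-- Condition (V): `V : (0, ∞) → [0, ∞]` is (Lebesgue) measurable and locally integrable on
`(0, ∞)`. Values of `V` outside `(0, ∞)` are irrelevant. -/
def CondV (V : ℝ → ℝ≥0∞) : Prop :=
  AEMeasurable V (volume.restrict (Ioi 0)) ∧
    ∀ C : Set ℝ, IsCompact C → C ⊆ Ioi 0 → ∫⁻ r in C, V r < ∞

/-- Condition (K): `K : (0, ∞) → (0, ∞)` is (Lebesgue) measurable and in `L^s_loc((0, ∞))` for
some `s > 1`. Values of `K` outside `(0, ∞)` are irrelevant. -/
def CondK (K : ℝ → ℝ) : Prop :=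
  AEMeasurable K (volume.restrict (Ioi 0)) ∧ (∀ r : ℝ, 0 < r → 0 < K r) ∧
    ∃ s : ℝ, 1 < s ∧
      ∀ C : Set ℝ, IsCompact C → C ⊆ Ioi 0 → ∫⁻ r in C, ENNReal.ofReal (K r) ^ s < ∞

/-- `q_*(α, β, γ) = 2 (α - γβ + N) / (N - γ)`. -/
def qStar (N : ℕ) (α β γ : ℝ) : ℝ :=
  2 * ((α - γ * β + N) / (N - γ))

/-- `q_{**}(α, β, γ) = 2 (2α + (1 - 2β)γ + 2(N - 2)) / (2(N - 2) - γ)`. -/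
def qStarStar (N : ℕ) (α β γ : ℝ) : ℝ :=
  2 * ((2 * α + (1 - 2 * β) * γ + 2 * ((N : ℝ) - 2)) / (2 * ((N : ℝ) - 2) - γ))

end Bilaplacian

end

noncomputable section

namespace Bilaplacian

/-! Set `ρ = ‖x‖ ^ 2` and write a radial unit vector as `u x = k (‖x‖ ^ 2)`. A radial test function
whose `ρ`-derivative is `ρ ^ (-N/2) * η ρ` has Laplacian `4 ρ ^ (1 - N/2) η'`. The power of `ρ`
cancels the density of Lebesgue measure in the variable `ρ`, so the weak Laplacian controls `∫ k η'`
(`abs_integral_profile_mul_deriv_le`). Letting `η` tend to the indicator of an interval gives a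
Lipschitz estimate for `k` on a set of full measure (`exists_lipschitz_profile`). Averaging it over
a short window against the bound `∫ V |u|² ≤ 1`, where `V ≥ lam * r ^ (-γ)`, yields `|u x| ≤ C ‖x‖ ^
(-ν)` with `ν = (2(N-2) - γ)/4` (`exists_pointwise_bound`).

The integrand `K |u|^(q-1) |h|` is then bounded for `‖x‖ ≥ R` by a vanishing function of `R` times
an integrable function (`tendsto_RInf_of_pointwise_le`). Since `V` is bounded below by a power of
`r`, `V ^ β` may be replaced by a higher power of `V` times a power of `r`. If `q < 2`, it is raised
to `V ^ (q/2)` and Young's inequality leaves a pure power of `r`, integrable at infinity exactly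
when there is room above `q_*`; no decay of `u` is needed. If `q ≥ 2`, it is raised to `V`, the
factor `|u|^(q-2)` is absorbed by the decay, and the remaining exponent of `r` is negative exactly
when `q > q_**`. -/

/-! ### Measurable radial profiles -/

/-- A radial function is a.e. of the form `k (‖x‖ ^ 2)` with `k` measurable. -/
lemma exists_measurable_profile {N : ℕ} (hN : 0 < N) {u : E N → ℝ}
    (hu : AEStronglyMeasurable u volume) (hr : IsRadial u) :
    ∃ k : ℝ → ℝ, Measurable k ∧ ∀ᵐ x : E N, u x = k (‖x‖ ^ 2) := by
  have : Nonempty (Fin N) := ⟨⟨0, hN⟩⟩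
  obtain ⟨g, hg⟩ := hr
  set v := hu.mk u
  have hvm : Measurable v := hu.stronglyMeasurable_mk.measurable
  have huv : ∀ᵐ x : E N, u x = v x := hu.ae_eq_mk
  have hv : ∀ᵐ x : E N, v x = g ‖x‖ := by
    filter_upwards [huv, hg] with x h1 h2
    rw [← h1, h2]
  set Φ := homeomorphUnitSphereProd (E N)
  have hmp := (volume : Measure (E N)).measurePreserving_homeomorphUnitSphereProd
  have hemb : MeasurableEmbedding (Subtype.val : ({0}ᶜ : Set (E N)) → E N) :=
    MeasurableEmbedding.subtype_coe (measurableSet_singleton _).compl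
  have hv' : ∀ᵐ x : ({0}ᶜ : Set (E N)) ∂(volume.comap Subtype.val), v x = g ‖(x : E N)‖ := by
    have := ae_restrict_of_ae (s := ({0}ᶜ : Set (E N))) hv
    rw [← map_comap_subtype_coe (measurableSet_singleton _).compl, hemb.ae_map_iff] at this
    exact this
  have hv2 : ∀ᵐ p ∂((volume : Measure (E N)).toSphere.prod
      (Measure.volumeIoiPow (Module.finrank ℝ (E N) - 1))), v (Φ.symm p) = g p.2 := by
    rw [← hmp.map_eq, (Homeomorph.measurableEmbedding _).ae_map_iff]
    filter_upwards [hv'] with x hx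
    simpa [Φ] using hx
  -- The function `g` need not be measurable. By Fubini in polar coordinates, the measurable `v`
  -- agrees with `g` a.e. along almost every ray; its restriction to one such ray replaces `g`.
  have hv3 := Measure.ae_ae_of_ae_prod hv2
  have : NeZero (volume : Measure (E N)).toSphere := ⟨Measure.toSphere_ne_zero _⟩
  obtain ⟨θ, hθ⟩ := hv3.exists
  have hv4 : ∀ᵐ p ∂((volume : Measure (E N)).toSphere.prod
      (Measure.volumeIoiPow (Module.finrank ℝ (E N) - 1))),
      v (Φ.symm (θ, p.2)) = g p.2 :=
    Measure.quasiMeasurePreserving_snd.ae hθ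
  have hv5 : ∀ᵐ x : ({0}ᶜ : Set (E N)) ∂(volume.comap Subtype.val),
      v (‖(x : E N)‖ • (θ : E N)) = g ‖(x : E N)‖ := by
    have := hmp.quasiMeasurePreserving.ae hv4
    filter_upwards [this] with x hx
    simpa [Φ] using hx
  have hv6 : ∀ᵐ x : E N, v (‖x‖ • (θ : E N)) = g ‖x‖ := by
    rw [← restrict_compl_singleton (μ := (volume : Measure (E N))) 0,
      ← map_comap_subtype_coe (measurableSet_singleton _).compl, hemb.ae_map_iff]
    exact hv5
  refine ⟨fun s => v (√s • (θ : E N)), by fun_prop, ?_⟩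
  filter_upwards [huv, hv, hv6] with x h1 h2 h3
  rw [Real.sqrt_sq (norm_nonneg x), h1, h2, h3]

/-! ### Lebesgue measure in the variable `ρ = ‖x‖ ^ 2` -/

/-- The normalising constant in `map_normSq`. -/
def normSqConst (N : ℕ) : ℝ := (N / 2 : ℝ) * (volume : Measure (E N)).real (Metric.ball 0 1)

lemma normSqConst_pos {N : ℕ} (hN : 0 < N) : 0 < normSqConst N := by
  have h : 0 < (volume : Measure (E N)).real (Metric.ball 0 1) :=
    ENNReal.toReal_pos (Metric.measure_ball_pos _ _ one_pos).ne' measure_ball_lt_top.ne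
  have : (0 : ℝ) < N := by exact_mod_cast hN
  unfold normSqConst
  positivity

/-- The density of the push-forward of Lebesgue measure under `x ↦ ‖x‖ ^ 2`. -/
def normSqDensity (N : ℕ) (s : ℝ) : ℝ := normSqConst N * s ^ ((N : ℝ) / 2 - 1)

lemma volume_normSq_lt {N : ℕ} (hN : 0 < N) (b : ℝ) :
    volume {x : E N | ‖x‖ ^ 2 < b} =
      ENNReal.ofReal ((volume : Measure (E N)).real (Metric.ball 0 1) * max b 0 ^ ((N : ℝ) / 2)) := by
  have : Nonempty (Fin N) := ⟨⟨0, hN⟩⟩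
  have hN' : (0 : ℝ) < N := by exact_mod_cast hN
  have hset : {x : E N | ‖x‖ ^ 2 < b} = Metric.ball 0 (√b) := by
    ext x
    simp [Real.lt_sqrt (norm_nonneg x)]
  rw [hset, Measure.addHaar_ball _ _ (Real.sqrt_nonneg _), finrank_euclideanSpace, Fintype.card_fin,
    mul_comm, ENNReal.ofReal_mul measureReal_nonneg, measureReal_def,
    ENNReal.ofReal_toReal measure_ball_lt_top.ne]
  congr 2
  rcases le_total b 0 with h | h
  · rw [Real.sqrt_eq_zero_of_nonpos h, max_eq_right h, Real.zero_rpow (by positivity),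
      zero_pow hN.ne']
  · rw [max_eq_left h, Real.sqrt_eq_rpow, ← Real.rpow_natCast, ← Real.rpow_mul h]
    congr 1; ring

/-- Both measures give each ray `Iio b` the same finite mass, and half-open intervals are
differences of rays. -/
lemma map_normSq {N : ℕ} (hN : 0 < N) :
    Measure.map (fun x : E N => ‖x‖ ^ 2) volume =
      (volume.restrict (Ioi 0)).withDensity (fun s => ENNReal.ofReal (normSqDensity N s)) := by
  have hN' : (0 : ℝ) < N := by exact_mod_cast hN
  have hm : Measurable (fun x : E N => ‖x‖ ^ 2) := by fun_prop
  have h1 : ∀ b, Measure.map (fun x : E N => ‖x‖ ^ 2) volume (Iio b) =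
      ENNReal.ofReal ((volume : Measure (E N)).real (Metric.ball 0 1) * max b 0 ^ ((N : ℝ) / 2)) := by
    intro b
    rw [Measure.map_apply hm measurableSet_Iio]
    exact volume_normSq_lt hN b
  have h2 : ∀ b, (volume.restrict (Ioi 0)).withDensity
      (fun s => ENNReal.ofReal (normSqDensity N s)) (Iio b) =
      ENNReal.ofReal ((volume : Measure (E N)).real (Metric.ball 0 1) * max b 0 ^ ((N : ℝ) / 2)) := by
    intro b
    rw [withDensity_apply _ measurableSet_Iio, Measure.restrict_restrict measurableSet_Iio]
    have hs : Iio b ∩ Ioi 0 = Ioo 0 b := by ext; simp [and_comm]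
    rw [hs]
    rcases le_total b 0 with h | h
    · simp [Ioo_eq_empty (not_lt.2 h), max_eq_right h, Real.zero_rpow (by positivity : (N : ℝ) / 2 ≠ 0)]
    · rw [Measure.restrict_congr_set Ioo_ae_eq_Ioc, ← ofReal_integral_eq_lintegral_ofReal]
      · rw [← intervalIntegral.integral_of_le h]
        unfold normSqDensity normSqConst
        rw [intervalIntegral.integral_const_mul, integral_rpow (Or.inl (by linarith)),
          max_eq_left h, sub_add_cancel, Real.zero_rpow (by positivity)]
        congr 1
        field_simp
        ring
      · rw [← IntegrableOn, ← intervalIntegrable_iff_integrableOn_Ioc_of_le h]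
        exact (intervalIntegral.intervalIntegrable_rpow' (by linarith)).const_mul _
      · filter_upwards [ae_restrict_mem measurableSet_Ioc] with s hs
        have := normSqConst_pos hN
        have := Real.rpow_nonneg hs.1.le ((N : ℝ) / 2 - 1)
        unfold normSqDensity
        positivity
  refine Measure.ext_of_Ico' _ _ ?_ ?_
  · intro a b _
    refine ((measure_mono (Ico_subset_Iio_self)).trans_lt ?_).ne
    rw [h1]; exact ENNReal.ofReal_lt_top
  · intro a b hab
    have hd : Ico a b = Iio b \ Iio a := Iio_sdiff_Iio.symm
    rw [hd, measure_sdiff (Iio_subset_Iio hab.le) measurableSet_Iio.nullMeasurableSet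
        (by rw [h1]; exact ENNReal.ofReal_ne_top),
      measure_sdiff (Iio_subset_Iio hab.le) measurableSet_Iio.nullMeasurableSet
        (by rw [h2]; exact ENNReal.ofReal_ne_top), h1, h1, h2, h2]

lemma normSqDensity_pos {N : ℕ} (hN : 0 < N) {s : ℝ} (hs : 0 < s) : 0 < normSqDensity N s :=
  mul_pos (normSqConst_pos hN) (Real.rpow_pos_of_pos hs _)

@[fun_prop]
lemma measurable_normSqDensity (N : ℕ) : Measurable (normSqDensity N) := by
  unfold normSqDensity; fun_prop

lemma lintegral_normSq {N : ℕ} (hN : 0 < N) {F : ℝ → ℝ≥0∞} (hF : Measurable F) :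
    ∫⁻ x : E N, F (‖x‖ ^ 2) = ∫⁻ s in Ioi 0, ENNReal.ofReal (normSqDensity N s) * F s := by
  rw [← lintegral_map hF (by fun_prop : Measurable fun x : E N => ‖x‖ ^ 2), map_normSq hN,
    lintegral_withDensity_eq_lintegral_mul _ (by fun_prop) hF]
  rfl

lemma integral_normSq {N : ℕ} (hN : 0 < N) {F : ℝ → ℝ} (hF : Measurable F) :
    ∫ x : E N, F (‖x‖ ^ 2) = ∫ s in Ioi 0, normSqDensity N s * F s := by
  rw [← integral_map (by fun_prop : Measurable fun x : E N => ‖x‖ ^ 2).aemeasurable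
    hF.aestronglyMeasurable, map_normSq hN,
    integral_withDensity_eq_integral_toReal_smul (by fun_prop) (by simp)]
  refine setIntegral_congr_fun measurableSet_Ioi fun s hs => ?_
  simp [ENNReal.toReal_ofReal (normSqDensity_pos hN hs).le]

lemma ae_normSq {N : ℕ} (hN : 0 < N) {p : ℝ → Prop} (h : ∀ᵐ s, 0 < s → p s) :
    ∀ᵐ x : E N, p (‖x‖ ^ 2) := by
  have hm : Measurable fun x : E N => ‖x‖ ^ 2 := by fun_prop
  refine ae_of_ae_map hm.aemeasurable ?_
  rw [map_normSq hN]
  refine (withDensity_absolutelyContinuous _ _).ae_le ?_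
  exact (ae_restrict_iff' measurableSet_Ioi).2 h

/-- Squaring is differentiable, so it maps null sets of radii to null sets of `ρ`, which reduces
this to `ae_normSq`. -/
lemma ae_norm {N : ℕ} (hN : 0 < N) {p : ℝ → Prop} (h : ∀ᵐ r, 0 < r → p r) :
    ∀ᵐ x : E N, p ‖x‖ := by
  have h0 : volume ((fun r : ℝ => r ^ 2) '' {r | ¬(0 < r → p r)}) = 0 :=
    addHaar_image_eq_zero_of_differentiableOn_of_addHaar_eq_zero _
      (by fun_prop) (ae_iff.1 h)
  have h1 : ∀ᵐ s : ℝ, 0 < s → p (√s) := by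
    refine measure_mono_null (fun s hs => ?_) h0
    simp only [mem_compl_iff, mem_ofPred_eq, Classical.not_imp] at hs
    exact ⟨√s, by simpa using hs, Real.sq_sqrt hs.1.le⟩
  filter_upwards [ae_normSq hN h1] with x hx
  rwa [Real.sqrt_sq (norm_nonneg x)] at hx

/-! ### Testing the weak Laplacian against radial functions -/

lemma fderiv_comp_normSq {N : ℕ} {χ θ : ℝ → ℝ} (hχ : ∀ s, HasDerivAt χ (θ s) s)
    (i : Fin N) (y : E N) :
    fderiv ℝ (fun x : E N => χ (‖x‖ ^ 2)) y (EuclideanSpace.single i 1) =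
      θ (‖y‖ ^ 2) * (2 * y i) := by
  have h1 : HasFDerivAt (fun x : E N => ‖x‖ ^ 2) (2 • (innerSL ℝ y)) y :=
    (hasStrictFDerivAt_norm_sq y).hasFDerivAt
  have h2 := (hχ (‖y‖ ^ 2)).comp_hasFDerivAt y h1
  have h3 : HasFDerivAt (fun x : E N => χ (‖x‖ ^ 2)) (θ (‖y‖ ^ 2) • (2 • (innerSL ℝ y))) y := h2
  rw [h3.fderiv]
  simp [EuclideanSpace.inner_single_right]

/-- The Laplacian of a smooth function of `‖x‖ ^ 2`. -/
lemma sum_secondPartial_comp_normSq {N : ℕ} {χ θ θ' : ℝ → ℝ} (hχ : ∀ s, HasDerivAt χ (θ s) s)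
    (hθ : ∀ s, HasDerivAt θ (θ' s) s) (x : E N) :
    ∑ i : Fin N, secondPartial (fun x : E N => χ (‖x‖ ^ 2)) i i x =
      2 * N * θ (‖x‖ ^ 2) + 4 * ‖x‖ ^ 2 * θ' (‖x‖ ^ 2) := by
  have key : ∀ i : Fin N, secondPartial (fun x : E N => χ (‖x‖ ^ 2)) i i x =
      2 * θ (‖x‖ ^ 2) + 4 * θ' (‖x‖ ^ 2) * (x i) ^ 2 := by
    intro i
    unfold secondPartial
    simp_rw [fderiv_comp_normSq hχ]
    have h1 : HasFDerivAt (fun x : E N => ‖x‖ ^ 2) (2 • (innerSL ℝ x)) x :=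
      (hasStrictFDerivAt_norm_sq x).hasFDerivAt
    have h3 : HasFDerivAt (fun x : E N => θ (‖x‖ ^ 2)) (θ' (‖x‖ ^ 2) • (2 • (innerSL ℝ x))) x :=
      (hθ (‖x‖ ^ 2)).comp_hasFDerivAt x h1
    have h4 : HasFDerivAt (fun x : E N => 2 * x i)
        ((2 : ℝ) • (EuclideanSpace.proj i : E N →L[ℝ] ℝ)) x :=
      ((EuclideanSpace.proj i : E N →L[ℝ] ℝ).hasFDerivAt).const_mul 2
    have h5 : HasFDerivAt (fun x : E N => θ (‖x‖ ^ 2) * (2 * x i)) _ x := h3.mul h4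
    rw [h5.fderiv]
    simp [EuclideanSpace.inner_single_right]
    ring
  simp_rw [key]
  rw [Finset.sum_add_distrib, ← Finset.mul_sum (f := fun i => x i ^ 2)]
  have h : ∑ i : Fin N, x i ^ 2 = ‖x‖ ^ 2 := by simp [EuclideanSpace.norm_sq_eq]
  rw [h]
  simp
  ring

lemma weakSecondPartial_spec {N : ℕ} {u : E N → ℝ} (hu : MemD22 u) (i j : Fin N) :
    IsWeakSecondPartial u i j (weakSecondPartial u i j) ∧ MemLp (weakSecondPartial u i j) 2 := by
  have h := hu.2 i j
  unfold weakSecondPartial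
  rw [dif_pos h]
  exact h.choose_spec

lemma memLp_weakLaplacian {N : ℕ} {u : E N → ℝ} (hu : MemD22 u) : MemLp (weakLaplacian u) 2 :=
  memLp_finsetSum _ fun i _ => (weakSecondPartial_spec hu i i).2

lemma continuous_secondPartial {N : ℕ} {φ : E N → ℝ} (hφ : ContDiff ℝ (⊤ : ℕ∞) φ) (i j : Fin N) :
    Continuous (secondPartial φ i j) := by
  have h1 : ContDiff ℝ (⊤ : ℕ∞) (fun y => fderiv ℝ φ y (EuclideanSpace.single i 1)) :=
    (hφ.fderiv_right (m := (⊤ : ℕ∞)) (by simp)).clm_apply contDiff_const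
  exact ((h1.fderiv_right (m := (⊤ : ℕ∞)) (by simp)).clm_apply contDiff_const).continuous

lemma hasCompactSupport_secondPartial {N : ℕ} {φ : E N → ℝ} (hc : HasCompactSupport φ)
    (i j : Fin N) : HasCompactSupport (secondPartial φ i j) :=
  (hc.fderiv_apply ℝ _).fderiv_apply ℝ _

/-- The weak Laplacian tested against a smooth compactly supported function. -/
lemma integral_mul_laplacian {N : ℕ} {u : E N → ℝ} (hu : MemD22 u) (hul : LocallyIntegrable u)
    {φ : E N → ℝ} (hφ : ContDiff ℝ (⊤ : ℕ∞) φ) (hc : HasCompactSupport φ) :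
    ∫ x, u x * ∑ i : Fin N, secondPartial φ i i x = ∫ x, weakLaplacian u x * φ x := by
  simp_rw [Finset.mul_sum, weakLaplacian, Finset.sum_mul]
  rw [integral_finsetSum, integral_finsetSum]
  · exact Finset.sum_congr rfl fun i _ => (weakSecondPartial_spec hu i i).1.2.2 φ hφ hc
  · intro i _
    exact (weakSecondPartial_spec hu i i).1.2.1.integrable_smul_right_of_hasCompactSupport
      hφ.continuous hc
  · intro i _
    exact hul.integrable_smul_right_of_hasCompactSupport
      (continuous_secondPartial hφ i i) (hasCompactSupport_secondPartial hc i i)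

lemma contDiff_integral {θ : ℝ → ℝ} (hθ : ContDiff ℝ (⊤ : ℕ∞) θ) (b : ℝ) :
    ContDiff ℝ (⊤ : ℕ∞) (fun r => ∫ s in b..r, θ s) ∧
      ∀ r, HasDerivAt (fun r => ∫ s in b..r, θ s) (θ r) r := by
  have h : ∀ r, HasDerivAt (fun r => ∫ s in b..r, θ s) (θ r) r := fun r =>
    intervalIntegral.integral_hasDerivAt_right (hθ.continuous.intervalIntegrable _ _)
      (hθ.continuous.stronglyMeasurableAtFilter _ _) hθ.continuous.continuousAt
  refine ⟨?_, h⟩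
  rw [contDiff_infty_iff_deriv]
  refine ⟨fun r => (h r).differentiableAt, ?_⟩
  rwa [show deriv (fun r => ∫ s in b..r, θ s) = θ from funext fun r => (h r).deriv]

/-- The singularity of the power at `0` is invisible because `η` vanishes to the left of `a > 0`. -/
lemma contDiff_rpow_mul {η : ℝ → ℝ} (hη : ContDiff ℝ (⊤ : ℕ∞) η) {a : ℝ} (ha : 0 < a)
    (h0 : ∀ s < a, η s = 0) (p : ℝ) : ContDiff ℝ (⊤ : ℕ∞) (fun s => s ^ p * η s) := by
  rw [contDiff_iff_contDiffAt]
  intro s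
  rcases lt_or_ge s a with h | h
  · refine (contDiffAt_const (c := (0 : ℝ))).congr_of_eventuallyEq ?_
    filter_upwards [Iio_mem_nhds h] with t ht
    rw [h0 t ht, mul_zero]
  · exact (Real.contDiffAt_rpow_const_of_ne (ha.trans_le h).ne').mul hη.contDiffAt

/-- Testing against radial functions whose Laplacian is `4 ρ ^ (1 - N / 2) η' (ρ)`, `ρ = ‖x‖ ^ 2`. -/
lemma abs_integral_profile_mul_deriv_le {N : ℕ} (hN : 0 < N) {u : E N → ℝ} (hu : MemD22 u)
    (hul : LocallyIntegrable u)
    (hf : ∫⁻ x, ‖weakLaplacian u x‖ₑ ^ 2 ≤ 1)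
    {k : ℝ → ℝ} (hk : Measurable k) (huk : ∀ᵐ x : E N, u x = k (‖x‖ ^ 2))
    {η : ℝ → ℝ} (hη : ContDiff ℝ (⊤ : ℕ∞) η) {a b : ℝ} (ha : 0 < a) (hab : a ≤ b)
    (h0 : ∀ s < a, η s = 0) (h1 : ∀ s, b < s → η s = 0) (hη0 : ∀ s, 0 ≤ η s) (hη1 : ∀ s, η s ≤ 1) :
    |∫ s in Ioi 0, k s * deriv η s| ≤
      √((volume : Measure (E N)).real (Metric.ball 0 1)) / (4 * normSqConst N) *
        (a ^ (-(N : ℝ) / 2) * b ^ ((N : ℝ) / 4) * (b - a)) := by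
  have hc := normSqConst_pos hN
  have hb : 0 < b := ha.trans_le hab
  set θ : ℝ → ℝ := fun s => s ^ (-(N : ℝ) / 2) * η s with hθdef
  have hθ : ContDiff ℝ (⊤ : ℕ∞) θ := contDiff_rpow_mul hη ha h0 _
  -- Starting the primitive at `b` makes `χ` vanish beyond `b`, hence `φ` compactly supported. Below
  -- `a` it is constant, not zero.
  set χ : ℝ → ℝ := fun r => ∫ s in b..r, θ s with hχdef
  obtain ⟨hχs, hχd⟩ := contDiff_integral hθ b
  have hθd : ∀ s, HasDerivAt θ (deriv θ s) s := fun s =>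
    (hθ.differentiable (by simp) s).hasDerivAt
  have hθ0 : ∀ s, 0 ≤ θ s := by
    intro s
    rcases lt_or_ge s a with h | h
    · simp [hθdef, h0 s h]
    · exact mul_nonneg (Real.rpow_nonneg (ha.le.trans h) _) (hη0 s)
  have hθ1 : ∀ s, θ s ≤ a ^ (-(N : ℝ) / 2) := by
    intro s
    rcases lt_or_ge s a with h | h
    · simp only [hθdef, h0 s h, mul_zero]; positivity
    · have h2 : s ^ (-(N : ℝ) / 2) ≤ a ^ (-(N : ℝ) / 2) :=
        Real.rpow_le_rpow_of_nonpos ha h (by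
          have : (0 : ℝ) ≤ N := N.cast_nonneg
          linarith)
      calc θ s ≤ s ^ (-(N : ℝ) / 2) * 1 := by
            exact mul_le_mul_of_nonneg_left (hη1 s) (Real.rpow_nonneg (ha.le.trans h) _)
        _ ≤ _ := by simpa using h2
  set M := a ^ (-(N : ℝ) / 2) * (b - a) with hM
  have hM0 : 0 ≤ M := mul_nonneg (by positivity) (by linarith)
  have hχb : ∀ r, b ≤ r → χ r = 0 := by
    intro r hr
    refine intervalIntegral.integral_zero_ae (Eventually.of_forall fun s hs => ?_)
    rw [uIoc_of_le hr] at hs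
    simp [hθdef, h1 s hs.1]
  have hχM : ∀ r, |χ r| ≤ M := by
    intro r
    rcases le_total b r with h | h
    · rw [hχb r h, abs_zero]; exact hM0
    · have e1 : χ r = -∫ s in r..b, θ s := intervalIntegral.integral_symm _ _
      have e2 : ∫ s in r..b, θ s ≤ M := by
        have e3 : ∫ s in r..b, θ s ≤ ∫ s in (min r a)..b, θ s :=
          intervalIntegral.integral_mono_interval (min_le_left _ _) h le_rfl
            (Eventually.of_forall hθ0) (hθ.continuous.intervalIntegrable _ _)
        have e4 : ∫ s in (min r a)..b, θ s = ∫ s in a..b, θ s := by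
          rw [← intervalIntegral.integral_add_adjacent_intervals (b := a)
            (hθ.continuous.intervalIntegrable _ _) (hθ.continuous.intervalIntegrable _ _)]
          rw [intervalIntegral.integral_zero_ae, zero_add]
          have : ∀ᵐ s : ℝ, s ≠ a := by simp [ae_iff]
          filter_upwards [this] with s hs1 hs
          rw [uIoc_of_le (min_le_right _ _)] at hs
          simp [hθdef, h0 s (lt_of_le_of_ne hs.2 hs1)]
        have e5 : ∫ s in a..b, θ s ≤ ∫ s in a..b, a ^ (-(N : ℝ) / 2) :=
          intervalIntegral.integral_mono_on hab (hθ.continuous.intervalIntegrable _ _)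
            (by simp) (fun s _ => hθ1 s)
        rw [intervalIntegral.integral_const, smul_eq_mul] at e5
        rw [hM]; linarith
      have e6 : 0 ≤ ∫ s in r..b, θ s := intervalIntegral.integral_nonneg h fun s _ => hθ0 s
      rw [e1, abs_neg, abs_of_nonneg e6]
      exact e2
  set φ : E N → ℝ := fun x => χ (‖x‖ ^ 2) with hφdef
  have hφ : ContDiff ℝ (⊤ : ℕ∞) φ := hχs.comp (contDiff_norm_sq ℝ)
  have hφ0 : ∀ x, x ∉ Metric.ball (0 : E N) (√b) → φ x = 0 := by
    intro x hx
    refine hχb _ ?_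
    simpa [Real.sqrt_le_left, Real.sqrt_le_iff] using hx
  have hφc : HasCompactSupport φ :=
    HasCompactSupport.intro (isCompact_closedBall (0 : E N) (√b)) fun x hx =>
      hφ0 x fun h => hx (Metric.ball_subset_closedBall h)
  have hweak := integral_mul_laplacian hu hul hφ hφc
  -- The term `2Nθ` cancels the derivative of `s ^ (-N/2)` in `4sθ'`, leaving `4 s ^ (1 - N/2) η'`;
  -- the density `normSqDensity` removes the power.
  have hlhs : ∫ x, u x * ∑ i : Fin N, secondPartial φ i i x =
      4 * normSqConst N * ∫ s in Ioi 0, k s * deriv η s := by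
    have e1 : ∫ x, u x * ∑ i : Fin N, secondPartial φ i i x =
        ∫ x : E N, (fun s => k s * (2 * N * θ s + 4 * s * deriv θ s)) (‖x‖ ^ 2) := by
      refine integral_congr_ae ?_
      filter_upwards [huk] with x hx
      simp only [hφdef]
      rw [hx, sum_secondPartial_comp_normSq hχd hθd]
    have hm : Measurable (fun s => k s * (2 * N * θ s + 4 * s * deriv θ s)) := by
      have := hθ.continuous.measurable
      have := measurable_deriv θ
      fun_prop
    rw [e1, integral_normSq hN hm, ← integral_const_mul]
    refine setIntegral_congr_fun measurableSet_Ioi fun s hs => ?_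
    have hs : 0 < s := hs
    have hd : deriv θ s = (-(N : ℝ) / 2) * s ^ (-(N : ℝ) / 2 - 1) * η s +
        s ^ (-(N : ℝ) / 2) * deriv η s :=
      ((Real.hasDerivAt_rpow_const (Or.inl hs.ne')).mul
        (hη.differentiable (by simp) s).hasDerivAt).deriv
    simp only [normSqDensity, hd]
    simp only [hθdef]
    have r1 : s ^ (-(N : ℝ) / 2 - 1) * s = s ^ (-(N : ℝ) / 2) := by
      rw [← Real.rpow_add_one hs.ne']; congr 1; ring
    have r2 : s ^ ((N : ℝ) / 2 - 1) * (s * s ^ (-(N : ℝ) / 2)) = 1 := by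
      rw [← mul_assoc, ← Real.rpow_add_one hs.ne', ← Real.rpow_add hs]
      ring_nf; simp
    linear_combination (normSqConst N * k s * s ^ ((N : ℝ) / 2 - 1) * (-2 * N * η s)) * r1 +
      (4 * normSqConst N * k s * deriv η s) * r2
  -- Cauchy–Schwarz, with `φ` bounded by `M` and supported in the ball of radius `√b`.
  have hrhs : |∫ x, weakLaplacian u x * φ x| ≤
      √((volume : Measure (E N)).real (Metric.ball 0 1)) * b ^ ((N : ℝ) / 4) * M := by
    have hv : volume (Metric.ball (0 : E N) (√b)) =
        ENNReal.ofReal ((volume : Measure (E N)).real (Metric.ball 0 1) * b ^ ((N : ℝ) / 2)) := by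
      have h := volume_normSq_lt hN b
      rw [max_eq_left hb.le] at h
      rw [← h]
      congr 1
      ext x
      simp [Real.lt_sqrt (norm_nonneg x)]
    have e1 : ‖∫ x, weakLaplacian u x * φ x‖ₑ ≤
        (∫⁻ x, ‖weakLaplacian u x‖ₑ ^ (2 : ℝ)) ^ (1 / 2 : ℝ) *
          (∫⁻ x, ‖φ x‖ₑ ^ (2 : ℝ)) ^ (1 / 2 : ℝ) := by
      refine (enorm_integral_le_lintegral_enorm _).trans ?_
      simp_rw [enorm_mul]
      exact ENNReal.lintegral_mul_le_Lp_mul_Lq _ Real.HolderConjugate.two_two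
        (memLp_weakLaplacian hu).1.enorm hφ.continuous.aestronglyMeasurable.enorm
    have e2 : (∫⁻ x, ‖weakLaplacian u x‖ₑ ^ (2 : ℝ)) ^ (1 / 2 : ℝ) ≤ 1 := by
      refine ENNReal.rpow_le_one ?_ (by norm_num)
      simpa using hf
    have e3 : ∫⁻ x, ‖φ x‖ₑ ^ (2 : ℝ) ≤ ENNReal.ofReal (M ^ 2 *
        ((volume : Measure (E N)).real (Metric.ball 0 1) * b ^ ((N : ℝ) / 2))) := by
      calc ∫⁻ x, ‖φ x‖ₑ ^ (2 : ℝ) ≤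
          ∫⁻ x, (Metric.ball (0 : E N) (√b)).indicator (fun _ => ENNReal.ofReal (M ^ 2)) x := by
            refine lintegral_mono fun x => ?_
            by_cases hx : x ∈ Metric.ball (0 : E N) (√b)
            · rw [indicator_of_mem hx, ENNReal.ofReal_pow hM0, ENNReal.rpow_two,
                ← ofReal_norm]
              gcongr
              exact hχM _
            · simp [hφ0 x hx]
        _ = _ := by
            rw [lintegral_indicator_const measurableSet_ball, hv, ← ENNReal.ofReal_mul (by positivity)]
    have e4 : (∫⁻ x, ‖φ x‖ₑ ^ (2 : ℝ)) ^ (1 / 2 : ℝ) ≤ ENNReal.ofReal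
        (√((volume : Measure (E N)).real (Metric.ball 0 1)) * b ^ ((N : ℝ) / 4) * M) := by
      refine (ENNReal.rpow_le_rpow e3 (by norm_num)).trans ?_
      rw [ENNReal.ofReal_rpow_of_nonneg (by positivity) (by norm_num), ← Real.sqrt_eq_rpow,
        Real.sqrt_mul (by positivity), Real.sqrt_mul (by positivity), Real.sqrt_sq hM0]
      refine ENNReal.ofReal_le_ofReal (le_of_eq ?_)
      have : √(b ^ ((N : ℝ) / 2)) = b ^ ((N : ℝ) / 4) := by
        rw [Real.sqrt_eq_rpow, ← Real.rpow_mul hb.le]; congr 1; ring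
      rw [this]; ring
    have e5 := e1.trans (mul_le_mul' e2 e4)
    rw [one_mul, ← ofReal_norm, ENNReal.ofReal_le_ofReal_iff (by positivity)] at e5
    exact e5
  rw [← hweak, hlhs, abs_mul, abs_of_pos (by positivity : (0 : ℝ) < 4 * normSqConst N)] at hrhs
  rw [div_mul_eq_mul_div, le_div_iff₀ (by positivity)]
  rw [hM] at hrhs
  linarith

lemma MemD22.locallyIntegrable {N : ℕ} (hN : 0 < N) {u : E N → ℝ} (hu : MemD22 u) :
    LocallyIntegrable u :=
  (weakSecondPartial_spec hu ⟨0, hN⟩ ⟨0, hN⟩).1.1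

/-! ### Mollification and the Lipschitz estimate for the profile -/

/-- The profile of a locally integrable radial function is locally integrable away from `0`. -/
lemma locallyIntegrable_indicator_profile {N : ℕ} (hN : 2 ≤ N) {u : E N → ℝ}
    (hul : LocallyIntegrable u) {k : ℝ → ℝ} (hk : Measurable k)
    (huk : ∀ᵐ x : E N, u x = k (‖x‖ ^ 2)) :
    LocallyIntegrable ((Ioi 1).indicator k) := by
  have hN0 : 0 < N := by omega
  have hc := normSqConst_pos hN0
  rw [locallyIntegrable_iff]
  intro K hK
  obtain ⟨T, hT⟩ := hK.bddAbove
  have hKT : K ⊆ Iic T := fun s hs => hT hs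
  refine IntegrableOn.mono_set ?_ hKT
  set F := (Iic T).indicator k with hF
  have hFm : Measurable F := hk.indicator measurableSet_Iic
  have h1 : Integrable (fun x : E N => F (‖x‖ ^ 2)) := by
    have hu' : IntegrableOn u (Metric.closedBall 0 (√T)) :=
      hul.integrableOn_isCompact (isCompact_closedBall _ _)
    rw [← integrable_indicator_iff Metric.isClosed_closedBall.measurableSet] at hu'
    refine hu'.mono (hFm.comp (by fun_prop)).aestronglyMeasurable ?_
    filter_upwards [huk] with x hx
    by_cases hxT : ‖x‖ ^ 2 ≤ T
    · have hxb : x ∈ Metric.closedBall (0 : E N) (√T) := by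
        rw [mem_closedBall_zero_iff]; exact Real.le_sqrt_of_sq_le hxT
      rw [indicator_of_mem hxb, hF, indicator_of_mem (by simpa using hxT), hx]
    · rw [hF, indicator_of_notMem (by simpa using hxT)]
      simp
  have h2 : Integrable F (Measure.map (fun x : E N => ‖x‖ ^ 2) volume) := by
    rw [integrable_map_measure hFm.aestronglyMeasurable (by fun_prop)]
    exact h1
  rw [map_normSq hN0, integrable_withDensity_iff_integrable_smul' (by fun_prop) (by simp)] at h2
  -- On `(1, ∞)` the density is at least `normSqConst N` because `N ≥ 2`, so the weight can be
  -- dropped. Near `0` it degenerates, hence the cut-off at `1`.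
  have h3 : IntegrableOn F (Ioi 1) := by
    have h4 := (IntegrableOn.mono_set (s := Ioi 1) h2 (Ioi_subset_Ioi zero_le_one)).const_mul
      (normSqConst N)⁻¹
    refine h4.mono hFm.aestronglyMeasurable ?_
    filter_upwards [ae_restrict_mem measurableSet_Ioi] with s hs
    have hs : 1 < s := hs
    have hd := normSqDensity_pos hN0 (zero_lt_one.trans hs)
    have h5 : 1 ≤ s ^ ((N : ℝ) / 2 - 1) := by
      refine Real.one_le_rpow hs.le ?_
      have : (2 : ℝ) ≤ N := by exact_mod_cast hN
      linarith
    rw [ENNReal.toReal_ofReal hd.le, smul_eq_mul, normSqDensity, ← mul_assoc, ← mul_assoc,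
      inv_mul_cancel₀ hc.ne', one_mul, norm_mul]
    exact le_mul_of_one_le_left (norm_nonneg _) (h5.trans (le_abs_self _))
  rw [← integrable_indicator_iff measurableSet_Ioi] at h3
  rw [← integrable_indicator_iff measurableSet_Iic]
  refine h3.congr (Eventually.of_forall fun s => ?_)
  rw [hF]
  simp only [indicator]
  split_ifs <;> rfl

/-- A primitive of a normalised bump function. -/
def bumpPrimitive (b : ContDiffBump (0 : ℝ)) (s : ℝ) : ℝ := ∫ y in (-1)..s, b.normed volume y

lemma hasDerivAt_bumpPrimitive (b : ContDiffBump (0 : ℝ)) (s : ℝ) :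
    HasDerivAt (bumpPrimitive b) (b.normed volume s) s :=
  (contDiff_integral b.contDiff_normed (-1)).2 s

lemma contDiff_bumpPrimitive (b : ContDiffBump (0 : ℝ)) :
    ContDiff ℝ (⊤ : ℕ∞) (bumpPrimitive b) :=
  (contDiff_integral b.contDiff_normed (-1)).1

lemma monotone_bumpPrimitive (b : ContDiffBump (0 : ℝ)) : Monotone (bumpPrimitive b) := by
  refine monotone_of_deriv_nonneg (fun s => (hasDerivAt_bumpPrimitive b s).differentiableAt)
    fun s => ?_
  rw [(hasDerivAt_bumpPrimitive b s).deriv]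
  exact b.nonneg_normed s

lemma bump_eq_zero (b : ContDiffBump (0 : ℝ)) {s : ℝ} (hs : b.rOut ≤ |s|) :
    b.normed volume s = 0 := by
  have : s ∉ Function.support (b.normed (volume : Measure ℝ)) := by
    rw [b.support_normed_eq]
    simpa using hs
  simpa using this

/-- The base point `-1` of the primitive lies to the left of the support of the bump because `rOut ≤
1`. -/
lemma bumpPrimitive_eq_zero {b : ContDiffBump (0 : ℝ)} (hb : b.rOut ≤ 1) {s : ℝ}
    (hs : s ≤ -b.rOut) : bumpPrimitive b s = 0 := by
  refine intervalIntegral.integral_zero_ae (Eventually.of_forall fun y hy => bump_eq_zero b ?_)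
  have h : y ≤ -b.rOut := hy.2.trans (max_le (by linarith) hs)
  rw [abs_of_nonpos (by linarith [b.rOut_pos])]
  linarith

lemma bumpPrimitive_eq_one {b : ContDiffBump (0 : ℝ)} (hb : b.rOut ≤ 1) {s : ℝ}
    (hs : b.rOut ≤ s) : bumpPrimitive b s = 1 := by
  rw [bumpPrimitive, intervalIntegral.integral_eq_integral_of_support_subset,
    b.integral_normed]
  rw [b.support_normed_eq, Real.ball_eq_Ioo]
  intro y hy
  exact ⟨by linarith [hy.1], by linarith [hy.2]⟩

lemma bumpPrimitive_mem_Icc {b : ContDiffBump (0 : ℝ)} (hb : b.rOut ≤ 1) (s : ℝ) :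
    bumpPrimitive b s ∈ Icc 0 1 := by
  constructor
  · rw [← bumpPrimitive_eq_zero hb (min_le_right s (-b.rOut))]
    exact monotone_bumpPrimitive b (min_le_left _ _)
  · rw [← bumpPrimitive_eq_one hb (le_max_right s b.rOut)]
    exact monotone_bumpPrimitive b (le_max_left _ _)

/-- The constant in `exists_lipschitz_profile`. -/
def lipConst (N : ℕ) : ℝ :=
  √((volume : Measure (E N)).real (Metric.ball 0 1)) / (4 * normSqConst N)

/-- A quantitative Lipschitz estimate for the profile, on a set of full measure. -/
lemma exists_lipschitz_profile {N : ℕ} (hN : 2 ≤ N) {u : E N → ℝ} (hu : MemD22 u)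
    (hf : ∫⁻ x, ‖weakLaplacian u x‖ₑ ^ 2 ≤ 1)
    {k : ℝ → ℝ} (hk : Measurable k) (huk : ∀ᵐ x : E N, u x = k (‖x‖ ^ 2)) :
    ∃ S : Set ℝ, (∀ᵐ s, s ∈ S) ∧ ∀ ρ ∈ S, ∀ t ∈ S, 1 < ρ → ρ < t →
      |k ρ - k t| ≤ lipConst N * (ρ ^ (-(N : ℝ) / 2) * t ^ ((N : ℝ) / 4) * (t - ρ)) := by
  have hN0 : 0 < N := by omega
  have hul := hu.locallyIntegrable hN0
  have hkl := locallyIntegrable_indicator_profile hN hul hk huk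
  set k₀ := (Ioi 1).indicator k with hk₀
  let ε : ℕ → ℝ := fun n => 1 / ((n : ℝ) + 1)
  have hε : ∀ n, 0 < ε n := fun n => by positivity
  -- The ratio of the radii is fixed at `2`, as a.e. convergence of the mollifications requires.
  let b : ℕ → ContDiffBump (0 : ℝ) := fun n =>
    ⟨ε n / 2, ε n, half_pos (hε n), half_lt_self (hε n)⟩
  have hε0 : Tendsto ε atTop (𝓝 0) := tendsto_one_div_add_atTop_nhds_zero_nat
  have hb1 : ∀ n, (b n).rOut ≤ 1 := fun n => by
    change 1 / ((n : ℝ) + 1) ≤ 1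
    rw [div_le_one (by positivity)]
    linarith [(n.cast_nonneg : (0 : ℝ) ≤ n)]
  have hconv := ContDiffBump.ae_convolution_tendsto_right_of_locallyIntegrable
    (φ := b) (l := atTop) (K := 2) (μ := volume) (g := k₀) hε0
    (Eventually.of_forall fun n => by change ε n ≤ 2 * (ε n / 2); linarith) hkl
  -- The good set consists of the points where the mollifications converge to `k₀`; it does not
  -- depend on the pair `ρ, t`.
  refine ⟨{x | Tendsto (fun i => convolution ((b i).normed volume) k₀
    (ContinuousLinearMap.lsmul ℝ ℝ) volume x) atTop (𝓝 (k₀ x))}, hconv, fun ρ hρ t ht h1ρ hρt => ?_⟩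
  have h1t := h1ρ.trans hρt
  have e1 : k₀ ρ = k ρ := indicator_of_mem h1ρ k
  have e2 : k₀ t = k t := indicator_of_mem h1t k
  have hlim := (Tendsto.sub (mem_ofPred_eq ▸ hρ) (mem_ofPred_eq ▸ ht)).abs
  rw [e1, e2] at hlim
  have hlim2 : Tendsto (fun n => lipConst N * ((ρ - ε n) ^ (-(N : ℝ) / 2) *
      (t + ε n) ^ ((N : ℝ) / 4) * ((t + ε n) - (ρ - ε n)))) atTop
      (𝓝 (lipConst N * ((ρ - 0) ^ (-(N : ℝ) / 2) * (t + 0) ^ ((N : ℝ) / 4) *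
        ((t + 0) - (ρ - 0))))) := by
    have a1 : Tendsto (fun n => ρ - ε n) atTop (𝓝 (ρ - 0)) := tendsto_const_nhds.sub hε0
    have a2 : Tendsto (fun n => t + ε n) atTop (𝓝 (t + 0)) := tendsto_const_nhds.add hε0
    exact (((a1.rpow_const (Or.inl (by linarith))).mul
      (a2.rpow_const (Or.inl (by linarith)))).mul (a2.sub a1)).const_mul _
  rw [sub_zero, add_zero] at hlim2
  refine le_of_tendsto_of_tendsto hlim hlim2 ?_
  -- Once `ε n < ρ - 1`, the bumps centred at `ρ` and `t` live in `(1, ∞)`, where `k₀ = k`.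
  filter_upwards [hε0.eventually (gt_mem_nhds (sub_pos.2 h1ρ))] with n hn
  set β := (b n).normed (volume : Measure ℝ) with hβ
  have hr : (b n).rOut = ε n := rfl
  -- A smoothed indicator of `[ρ, t]`: integrating `k` against `η'` gives the difference of the
  -- mollified values at `ρ` and `t`.
  set η : ℝ → ℝ := fun s => bumpPrimitive (b n) (s - ρ) - bumpPrimitive (b n) (s - t) with hη
  have hηd : ∀ s, deriv η s = β (ρ - s) - β (t - s) := by
    intro s
    have d1 := (hasDerivAt_bumpPrimitive (b n) (s - ρ)).comp_sub_const s ρ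
    have d2 := (hasDerivAt_bumpPrimitive (b n) (s - t)).comp_sub_const s t
    have d3 : HasDerivAt η _ s := d1.sub d2
    rw [d3.deriv, ← neg_sub ρ s, ← neg_sub t s, (b n).normed_neg,
      (b n).normed_neg]
  have hηs : ContDiff ℝ (⊤ : ℕ∞) η :=
    ((contDiff_bumpPrimitive (b n)).comp (contDiff_id.sub contDiff_const)).sub
      ((contDiff_bumpPrimitive (b n)).comp (contDiff_id.sub contDiff_const))
  have main := abs_integral_profile_mul_deriv_le hN0 hu hul hf hk huk hηs (a := ρ - ε n)
    (b := t + ε n) (by linarith) (by linarith [hε n])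
    (fun s hs => by
      simp only [hη]
      rw [bumpPrimitive_eq_zero (hb1 n) (by rw [hr]; linarith),
        bumpPrimitive_eq_zero (hb1 n) (by rw [hr]; linarith), sub_zero])
    (fun s hs => by
      simp only [hη]
      rw [bumpPrimitive_eq_one (hb1 n) (by rw [hr]; linarith),
        bumpPrimitive_eq_one (hb1 n) (by rw [hr]; linarith), sub_self])
    (fun s => sub_nonneg.2 (monotone_bumpPrimitive (b n) (by linarith)))
    (fun s => by
      have i1 := (bumpPrimitive_mem_Icc (hb1 n) (s - ρ)).2
      have i2 := (bumpPrimitive_mem_Icc (hb1 n) (s - t)).1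
      simp only [hη]; linarith)
  refine le_trans (le_of_eq ?_) main
  congr 1
  have hint : ∀ z : ℝ, Integrable (fun s => β (z - s) * k₀ s) := by
    intro z
    have hcs : HasCompactSupport (fun s => β (z - s)) :=
      (b n).hasCompactSupport_normed.comp_homeomorph (Homeomorph.subLeft z)
    have hcont : Continuous (fun s => β (z - s)) :=
      (b n).continuous_normed.comp (by fun_prop)
    exact hkl.integrable_smul_left_of_hasCompactSupport hcont hcs
  simp only [convolution_eq_swap, ContinuousLinearMap.lsmul_apply, smul_eq_mul]
  rw [← integral_sub (hint ρ) (hint t), ← integral_indicator measurableSet_Ioi]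
  refine integral_congr_ae (Eventually.of_forall fun s => ?_)
  simp only [hηd, hk₀]
  by_cases hs : 1 < s
  · rw [indicator_of_mem (show s ∈ Ioi 1 from hs),
      indicator_of_mem (show s ∈ Ioi 0 from zero_lt_one.trans hs)]
    ring
  · have z1 : β (ρ - s) = 0 := bump_eq_zero _ (by
      rw [hr, abs_of_nonneg (by linarith)]; linarith)
    have z2 : β (t - s) = 0 := bump_eq_zero _ (by
      rw [hr, abs_of_nonneg (by linarith)]; linarith)
    simp [indicator, z1, z2]

lemma lipConst_nonneg {N : ℕ} (hN : 0 < N) : 0 ≤ lipConst N := by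
  have := normSqConst_pos hN
  unfold lipConst
  positivity

/-! ### Pointwise decay -/

/-- A function with a Lipschitz bound and a weighted `L²` bound on `(s₀, ∞)` decays. -/
lemma sq_le_of_lipschitz_of_lintegral {N : ℕ} (hN : 5 ≤ N) {γ : ℝ} (hγ : γ ≤ 4) {L A s₀ : ℝ}
    (hL : 0 ≤ L) (hA : 0 ≤ A) (hs₀ : 1 ≤ s₀) {k : ℝ → ℝ} {S : Set ℝ}
    (hS : ∀ᵐ s, s ∈ S)
    (hlip : ∀ ρ ∈ S, ∀ t ∈ S, 1 < ρ → ρ < t →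
      |k ρ - k t| ≤ L * (ρ ^ (-(N : ℝ) / 2) * t ^ ((N : ℝ) / 4) * (t - ρ)))
    (hint : ∫⁻ s in Ioi s₀, ENNReal.ofReal (s ^ ((N : ℝ) / 2 - 1 - γ / 2)) *
      ENNReal.ofReal (k s ^ 2) ≤ ENNReal.ofReal A)
    {ρ : ℝ} (hρS : ρ ∈ S) (hρ : s₀ < ρ) :
    k ρ ^ 2 ≤ (2 * (L * 2 ^ ((N : ℝ) / 4)) ^ 2 + 4 * A) * ρ ^ (-((N : ℝ) / 2 - 1 - γ / 4)) := by
  have hN' : (5 : ℝ) ≤ N := by exact_mod_cast hN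
  have hρ1 : 1 < ρ := hs₀.trans_lt hρ
  have hρ0 : 0 < ρ := by linarith
  set w := (N : ℝ) / 2 - 1 - γ / 2 with hw
  set ν := (N : ℝ) / 2 - 1 - γ / 4 with hν
  -- The window length making the squared Lipschitz error `ρ ^ (-N/2) * d ^ 2` equal to the target
  -- `ρ ^ (-ν)`. The condition `γ ≤ 4` gives `d ≤ ρ` and, in `hwd`, makes the averaged `L²` term no
  -- larger.
  set d := ρ ^ (1 / 2 + γ / 8) with hd
  have hd0 : 0 < d := Real.rpow_pos_of_pos hρ0 _
  have hdρ : d ≤ ρ := by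
    calc d ≤ ρ ^ (1 : ℝ) := Real.rpow_le_rpow_of_exponent_le hρ1.le (by linarith)
      _ = ρ := Real.rpow_one ρ
  set Λ := L * 2 ^ ((N : ℝ) / 4) with hΛ
  have hΛ0 : 0 ≤ Λ := by positivity
  have hlip2 : ∀ t ∈ S, t ∈ Ioo ρ (ρ + d) → |k ρ - k t| ≤ Λ * (ρ ^ (-(N : ℝ) / 4) * d) := by
    intro t ht htd
    refine (hlip ρ hρS t ht hρ1 htd.1).trans ?_
    have a1 : t ^ ((N : ℝ) / 4) ≤ 2 ^ ((N : ℝ) / 4) * ρ ^ ((N : ℝ) / 4) := by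
      rw [← Real.mul_rpow (by norm_num) hρ0.le]
      exact Real.rpow_le_rpow (by linarith [htd.1]) (by linarith [htd.2]) (by linarith)
    have a2 : t - ρ ≤ d := by linarith [htd.2]
    have a3 : ρ ^ (-(N : ℝ) / 2) * ρ ^ ((N : ℝ) / 4) = ρ ^ (-(N : ℝ) / 4) := by
      rw [← Real.rpow_add hρ0]; congr 1; ring
    calc L * (ρ ^ (-(N : ℝ) / 2) * t ^ ((N : ℝ) / 4) * (t - ρ)) ≤
        L * (ρ ^ (-(N : ℝ) / 2) * (2 ^ ((N : ℝ) / 4) * ρ ^ ((N : ℝ) / 4)) * d) := by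
          have := sub_nonneg.2 htd.1.le
          gcongr
      _ = _ := by rw [hΛ, ← a3]; ring
  have hsq : ∀ t ∈ S, t ∈ Ioo ρ (ρ + d) → k ρ ^ 2 ≤ 2 * Λ ^ 2 * ρ ^ (-ν) + 2 * k t ^ 2 := by
    intro t ht htd
    have b1 := hlip2 t ht htd
    have b2 : (k ρ - k t) ^ 2 ≤ (Λ * (ρ ^ (-(N : ℝ) / 4) * d)) ^ 2 := by
      rw [← sq_abs]; gcongr
    have b3 : (ρ ^ (-(N : ℝ) / 4) * d) ^ 2 = ρ ^ (-ν) := by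
      rw [hd, ← Real.rpow_add hρ0, ← Real.rpow_natCast, ← Real.rpow_mul hρ0.le]
      congr 1; rw [hν]; push_cast; ring
    rw [mul_pow, b3] at b2
    nlinarith [sq_nonneg (k ρ - 2 * k t)]
  have hweight : ∀ t ∈ Ioo ρ (ρ + d), 1 ≤ 2 * ρ ^ (-w) * t ^ w := by
    intro t ht
    have ht0 : 0 < t := hρ0.trans ht.1
    -- The exponent `w` may be negative, but `N ≥ 5` and `γ ≤ 4` give `w ≥ -1`; with `t ≤ 2ρ` the
    -- weight loses at most a factor `2`.
    have c1 : (t / ρ) ^ (-1 : ℝ) ≤ (t / ρ) ^ w :=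
      Real.rpow_le_rpow_of_exponent_le (by rw [le_div_iff₀ hρ0]; linarith [ht.1]) (by linarith)
    rw [Real.rpow_neg_one, inv_div, Real.div_rpow ht0.le hρ0.le, div_eq_mul_inv _ (ρ ^ w),
      ← Real.rpow_neg hρ0.le] at c1
    have c2 : 1 / 2 ≤ ρ / t := by
      rw [div_le_div_iff₀ (by norm_num) ht0]; linarith [ht.2]
    linarith
  have hI : ENNReal.ofReal (k ρ ^ 2 * d) ≤
      ENNReal.ofReal (2 * Λ ^ 2 * ρ ^ (-ν) * d + 4 * ρ ^ (-w) * A) := by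
    have hvol : volume (Ioo ρ (ρ + d)) = ENNReal.ofReal d := by simp
    calc ENNReal.ofReal (k ρ ^ 2 * d)
        = ∫⁻ _ in Ioo ρ (ρ + d), ENNReal.ofReal (k ρ ^ 2) := by
          rw [setLIntegral_const, hvol, ← ENNReal.ofReal_mul (sq_nonneg _)]
      _ ≤ ∫⁻ t in Ioo ρ (ρ + d), (ENNReal.ofReal (2 * Λ ^ 2 * ρ ^ (-ν)) +
            ENNReal.ofReal (4 * ρ ^ (-w)) *
              (ENNReal.ofReal (t ^ w) * ENNReal.ofReal (k t ^ 2))) := by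
          refine lintegral_mono_ae ?_
          filter_upwards [ae_restrict_mem measurableSet_Ioo, ae_restrict_of_ae hS] with t ht htS
          have ht0 : 0 < t := hρ0.trans ht.1
          rw [← ENNReal.ofReal_mul (by positivity), ← ENNReal.ofReal_mul (by positivity),
            ← ENNReal.ofReal_add (by positivity) (by positivity)]
          refine ENNReal.ofReal_le_ofReal ((hsq t htS ht).trans ?_)
          have := mul_le_mul_of_nonneg_right (hweight t ht) (sq_nonneg (k t))
          linarith
      _ = ENNReal.ofReal (2 * Λ ^ 2 * ρ ^ (-ν)) * ENNReal.ofReal d +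
            ENNReal.ofReal (4 * ρ ^ (-w)) * ∫⁻ t in Ioo ρ (ρ + d),
              (ENNReal.ofReal (t ^ w) * ENNReal.ofReal (k t ^ 2)) := by
          rw [lintegral_add_left measurable_const, setLIntegral_const, hvol,
            lintegral_const_mul' _ _ ENNReal.ofReal_ne_top]
      _ ≤ ENNReal.ofReal (2 * Λ ^ 2 * ρ ^ (-ν)) * ENNReal.ofReal d +
            ENNReal.ofReal (4 * ρ ^ (-w)) * ENNReal.ofReal A := by
          gcongr
          refine le_trans (lintegral_mono_set ?_) hint
          intro t ht
          exact hρ.trans ht.1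
      _ = _ := by
          rw [← ENNReal.ofReal_mul (by positivity), ← ENNReal.ofReal_mul (by positivity),
            ← ENNReal.ofReal_add (by positivity) (by positivity)]
  rw [ENNReal.ofReal_le_ofReal_iff (by positivity)] at hI
  have hwd : ρ ^ (-w) ≤ ρ ^ (-ν) * d := by
    rw [hd, ← Real.rpow_add hρ0]
    exact Real.rpow_le_rpow_of_exponent_le hρ1.le (by rw [hw, hν]; linarith)
  have hfin : k ρ ^ 2 * d ≤ ((2 * Λ ^ 2 + 4 * A) * ρ ^ (-ν)) * d := by
    have := mul_le_mul_of_nonneg_left hwd (by positivity : 0 ≤ 4 * A)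
    linarith
  exact le_of_mul_le_mul_right hfin hd0

lemma lintegral_le_one_of_normH2 {N : ℕ} {V : ℝ → ℝ≥0∞} {u : E N → ℝ} (hu : normH2 V u = 1) :
    ∫⁻ x, ‖weakLaplacian u x‖ₑ ^ 2 ≤ 1 ∧ ∫⁻ x, V ‖x‖ * ‖u x‖ₑ ^ 2 ≤ 1 := by
  have h : ∫⁻ x, (‖weakLaplacian u x‖ₑ ^ 2 + V ‖x‖ * ‖u x‖ₑ ^ 2) = 1 := by
    unfold normH2 at hu
    have := congrArg (fun y => y ^ (2 : ℝ)) hu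
    rw [← ENNReal.rpow_mul] at this
    simpa using this
  exact ⟨h ▸ lintegral_mono fun x => le_self_add, h ▸ lintegral_mono fun x => le_add_self⟩

/-- The pointwise decay of unit vectors of `H²_{V,r}` when `V(r) ≥ lam * r ^ (-γ)` for large `r`. -/
lemma exists_pointwise_bound {N : ℕ} (hN : 5 ≤ N) {V : ℝ → ℝ≥0∞} {R₂ γ lam : ℝ} (hγ : γ ≤ 4)
    (hlam : 0 < lam)
    (hV : ∀ᵐ r, R₂ < r → ENNReal.ofReal lam ≤ ENNReal.ofReal (r ^ γ) * V r) :
    ∃ C : ℝ, 0 < C ∧ ∀ u : E N → ℝ, MemH2Rad V u → normH2 V u = 1 →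
      ∀ᵐ x : E N, max 1 R₂ < ‖x‖ → |u x| ≤ C * ‖x‖ ^ (-((2 * ((N : ℝ) - 2) - γ) / 4)) := by
  have hN0 : 0 < N := by omega
  have hc := normSqConst_pos hN0
  have hLc := lipConst_nonneg hN0
  -- One factor comes from the density of `ρ`, the other from `V ≥ lam * r ^ (-γ)`.
  set A := (normSqConst N)⁻¹ * lam⁻¹ with hA
  have hA0 : 0 < A := by positivity
  refine ⟨√(2 * (lipConst N * 2 ^ ((N : ℝ) / 4)) ^ 2 + 4 * A), by positivity,
    fun u hu hu1 => ?_⟩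
  obtain ⟨hf, hVu⟩ := lintegral_le_one_of_normH2 hu1
  have hD := hu.1.1
  obtain ⟨k, hk, huk⟩ := exists_measurable_profile hN0 hD.1.1 hu.2
  obtain ⟨S, hS, hlip⟩ := exists_lipschitz_profile (by omega) hD hf hk huk
  set s₀ := (max 1 R₂) ^ 2 with hs₀
  have h1s₀ : 1 ≤ s₀ := one_le_pow₀ (le_max_left _ _)
  have hVx : ∀ᵐ x : E N, R₂ < ‖x‖ → ENNReal.ofReal lam ≤ ENNReal.ofReal (‖x‖ ^ γ) * V ‖x‖ :=
    ae_norm hN0 (hV.mono fun r hr _ => hr)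
  set F : ℝ → ℝ≥0∞ := (Ioi s₀).indicator
    (fun s => ENNReal.ofReal (s ^ (-(γ / 2))) * ENNReal.ofReal (k s ^ 2)) with hF
  have hFm : Measurable F := Measurable.indicator (by fun_prop) measurableSet_Ioi
  have hF1 : ∫⁻ x : E N, F (‖x‖ ^ 2) ≤ ENNReal.ofReal lam⁻¹ := by
    calc ∫⁻ x : E N, F (‖x‖ ^ 2) ≤ ∫⁻ x : E N, ENNReal.ofReal lam⁻¹ * (V ‖x‖ * ‖u x‖ₑ ^ 2) := by
          refine lintegral_mono_ae ?_
          filter_upwards [hVx, huk] with x hx hxu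
          by_cases hxs : s₀ < ‖x‖ ^ 2
          · have hxR : max 1 R₂ < ‖x‖ := lt_of_pow_lt_pow_left₀ 2 (norm_nonneg x) hxs
            have hx0 : 0 < ‖x‖ := by linarith [le_max_left 1 R₂]
            rw [hF, indicator_of_mem (show ‖x‖ ^ 2 ∈ Ioi s₀ from hxs), ← hxu, ← mul_assoc]
            have e1 : ENNReal.ofReal (u x ^ 2) = ‖u x‖ₑ ^ 2 := by
              rw [← sq_abs, ENNReal.ofReal_pow (abs_nonneg _), ← Real.norm_eq_abs, ofReal_norm]
            rw [e1]
            gcongr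
            have e2 : (‖x‖ ^ 2) ^ (-(γ / 2)) = ‖x‖ ^ (-γ) := by
              rw [← Real.rpow_natCast, ← Real.rpow_mul hx0.le]; congr 1; push_cast; ring
            have e3 := hx ((le_max_right _ _).trans_lt hxR)
            calc ENNReal.ofReal ((‖x‖ ^ 2) ^ (-(γ / 2)))
                = ENNReal.ofReal (lam⁻¹ * ‖x‖ ^ (-γ)) * ENNReal.ofReal lam := by
                  rw [e2, ← ENNReal.ofReal_mul (by positivity)]
                  congr 1; field_simp
              _ ≤ ENNReal.ofReal (lam⁻¹ * ‖x‖ ^ (-γ)) * (ENNReal.ofReal (‖x‖ ^ γ) * V ‖x‖) := by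
                  gcongr
              _ = ENNReal.ofReal lam⁻¹ * V ‖x‖ := by
                  rw [← mul_assoc, ← ENNReal.ofReal_mul (by positivity), mul_assoc,
                    ← Real.rpow_add hx0, neg_add_cancel, Real.rpow_zero, mul_one]
          · rw [hF, indicator_of_notMem (by simpa using hxs)]
            exact zero_le
      _ = ENNReal.ofReal lam⁻¹ * ∫⁻ x : E N, V ‖x‖ * ‖u x‖ₑ ^ 2 :=
          lintegral_const_mul' _ _ ENNReal.ofReal_ne_top
      _ ≤ ENNReal.ofReal lam⁻¹ * 1 := by gcongr
      _ = _ := mul_one _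
  have hint : ∫⁻ s in Ioi s₀, ENNReal.ofReal (s ^ ((N : ℝ) / 2 - 1 - γ / 2)) *
      ENNReal.ofReal (k s ^ 2) ≤ ENNReal.ofReal A := by
    calc ∫⁻ s in Ioi s₀, ENNReal.ofReal (s ^ ((N : ℝ) / 2 - 1 - γ / 2)) *
          ENNReal.ofReal (k s ^ 2)
        = ∫⁻ s in Ioi s₀, ENNReal.ofReal (normSqConst N)⁻¹ *
            (ENNReal.ofReal (normSqDensity N s) * F s) := by
          refine setLIntegral_congr_fun measurableSet_Ioi fun s hs => ?_
          have hs0 : 0 < s := by linarith [show s₀ < s from hs]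
          have hds := normSqDensity_pos hN0 hs0
          simp only [hF, indicator_of_mem hs]
          rw [← mul_assoc, ← mul_assoc, ← ENNReal.ofReal_mul (by positivity),
            ← ENNReal.ofReal_mul (by positivity)]
          rw [normSqDensity, ← mul_assoc, inv_mul_cancel₀ hc.ne', one_mul,
            ← ENNReal.ofReal_mul (by positivity), ← ENNReal.ofReal_mul (by positivity),
            ← Real.rpow_add hs0]
          congr 1
      _ ≤ ∫⁻ s in Ioi 0, ENNReal.ofReal (normSqConst N)⁻¹ *
            (ENNReal.ofReal (normSqDensity N s) * F s) :=
          lintegral_mono_set (Ioi_subset_Ioi (by linarith))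
      _ = ENNReal.ofReal (normSqConst N)⁻¹ * ∫⁻ x : E N, F (‖x‖ ^ 2) := by
          rw [lintegral_const_mul' _ _ ENNReal.ofReal_ne_top, lintegral_normSq hN0 hFm]
      _ ≤ ENNReal.ofReal (normSqConst N)⁻¹ * ENNReal.ofReal lam⁻¹ := by gcongr
      _ = _ := by rw [← ENNReal.ofReal_mul (by positivity)]
  have hx := ae_normSq hN0 (hS.mono fun s hs (_ : 0 < s) => hs)
  filter_upwards [hx, huk] with x hxS hxu hxR
  have hx0 : 0 < ‖x‖ := by linarith [le_max_left 1 R₂]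
  have hb := sq_le_of_lipschitz_of_lintegral hN hγ hLc hA0.le h1s₀ hS hlip hint hxS
    (by rw [hs₀]; gcongr)
  rw [← hxu] at hb
  refine (Real.abs_le_sqrt hb).trans (le_of_eq ?_)
  rw [Real.sqrt_mul (by positivity)]
  congr 1
  rw [Real.sqrt_eq_rpow, ← Real.rpow_mul (by positivity), ← Real.rpow_natCast,
    ← Real.rpow_mul hx0.le]
  congr 1
  push_cast; ring

/-! ### Reduction to pointwise estimates of the integrand -/

lemma CondV.aemeasurable_norm {N : ℕ} (hN : 0 < N) {V : ℝ → ℝ≥0∞} (hV : CondV V) :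
    AEMeasurable (fun x : E N => V ‖x‖) := by
  obtain ⟨V', hV'm, hV'⟩ := hV.1
  refine ⟨fun x => V' ‖x‖, hV'm.comp measurable_norm, ?_⟩
  exact ae_norm hN (p := fun r => V r = V' r) ((ae_restrict_iff' measurableSet_Ioi).1 hV')

/-- A pointwise criterion for `R_∞(q, R) → 0`. -/
lemma tendsto_RInf_of_pointwise_le {N : ℕ} (hN : 0 < N) {V : ℝ → ℝ≥0∞} {K : ℝ → ℝ}
    (hV : CondV V) {q R₀ : ℝ} {G : E N → ℝ≥0∞} (hG : ∫⁻ x, G x < ∞) {ε : ℝ → ℝ}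
    (hε : Tendsto ε atTop (𝓝 0))
    (hb : ∀ u h : E N → ℝ, MemH2Rad V u → MemH2Rad V h → normH2 V u = 1 → normH2 V h = 1 →
      ∀ᵐ x, ∀ R, R₀ < R → R ≤ ‖x‖ → ENNReal.ofReal (K ‖x‖ * |u x| ^ (q - 1) * |h x|) ≤
        ENNReal.ofReal (ε R) * (V ‖x‖ * ‖u x‖ₑ ^ 2 + V ‖x‖ * ‖h x‖ₑ ^ 2 + G x)) :
    Tendsto (fun R => RInf N V K q R) atTop (𝓝 0) := by
  have hVm := hV.aemeasurable_norm hN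
  have hle : ∀ R, R₀ < R → RInf N V K q R ≤ ENNReal.ofReal (ε R) * (1 + 1 + ∫⁻ x, G x) := by
    intro R hR
    refine iSup_le fun u => iSup_le fun h => iSup_le fun hu => iSup_le fun hh =>
      iSup_le fun hu1 => iSup_le fun hh1 => ?_
    have hm : ∀ w : E N → ℝ, MemH2Rad V w → AEMeasurable (fun x => V ‖x‖ * ‖w x‖ₑ ^ 2) :=
      fun w hw => hVm.mul (hw.1.1.1.1.enorm.pow_const 2)
    calc ∫⁻ x in (Metric.ball (0 : E N) R)ᶜ, ENNReal.ofReal (K ‖x‖ * |u x| ^ (q - 1) * |h x|)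
        ≤ ∫⁻ x in (Metric.ball (0 : E N) R)ᶜ, ENNReal.ofReal (ε R) *
            (V ‖x‖ * ‖u x‖ₑ ^ 2 + V ‖x‖ * ‖h x‖ₑ ^ 2 + G x) := by
          refine lintegral_mono_ae ?_
          filter_upwards [ae_restrict_mem measurableSet_ball.compl,
            ae_restrict_of_ae (hb u h hu hh hu1 hh1)] with x hx hx2
          exact hx2 R hR (by simpa using hx)
      _ ≤ ∫⁻ x, ENNReal.ofReal (ε R) *
            (V ‖x‖ * ‖u x‖ₑ ^ 2 + V ‖x‖ * ‖h x‖ₑ ^ 2 + G x) := setLIntegral_le_lintegral _ _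
      _ = ENNReal.ofReal (ε R) *
            ((∫⁻ x, V ‖x‖ * ‖u x‖ₑ ^ 2) + (∫⁻ x, V ‖x‖ * ‖h x‖ₑ ^ 2) + ∫⁻ x, G x) := by
          rw [lintegral_const_mul' _ _ ENNReal.ofReal_ne_top,
            lintegral_add_left' (f := fun x => V ‖x‖ * ‖u x‖ₑ ^ 2 + V ‖x‖ * ‖h x‖ₑ ^ 2)
              ((hm u hu).add (hm h hh)), lintegral_add_left' (hm u hu)]
      _ ≤ _ := by
          gcongr
          · exact (lintegral_le_one_of_normH2 hu1).2
          · exact (lintegral_le_one_of_normH2 hh1).2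
  have hlim : Tendsto (fun R => ENNReal.ofReal (ε R) * (1 + 1 + ∫⁻ x, G x)) atTop (𝓝 0) := by
    have h := ENNReal.Tendsto.mul_const (b := 1 + 1 + ∫⁻ x, G x) (ENNReal.tendsto_ofReal hε)
      (Or.inr (by finiteness))
    simpa using h
  refine tendsto_of_tendsto_of_tendsto_of_le_of_le' tendsto_const_nhds hlim
    (Eventually.of_forall fun _ => zero_le) ?_
  filter_upwards [eventually_gt_atTop R₀] with R hR using hle R hR

/-- Trading powers of a potential bounded below by `lam * r ^ (-γ)` for powers of `r`. -/
lemma rpow_le_rpow_mul_of_le {v r lam γ β θ : ℝ} (hr : 0 < r) (hlam : 0 < lam)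
    (hv : lam ≤ r ^ γ * v) (hβθ : β ≤ θ) :
    v ^ β ≤ lam ^ (β - θ) * r ^ (γ * (θ - β)) * v ^ θ := by
  have hrγ : 0 < r ^ γ := Real.rpow_pos_of_pos hr _
  have hv0 : 0 < v := pos_of_mul_pos_right (hlam.trans_le hv) hrγ.le
  have h1 : (r ^ γ * v) ^ (β - θ) ≤ lam ^ (β - θ) :=
    Real.rpow_le_rpow_of_nonpos hlam hv (by linarith)
  have h2 : v ^ β = (r ^ γ * v) ^ (β - θ) * r ^ (γ * (θ - β)) * v ^ θ := by
    rw [Real.mul_rpow hrγ.le hv0.le, ← Real.rpow_mul hr.le, mul_right_comm (r ^ _),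
      ← Real.rpow_add hr, mul_assoc, ← Real.rpow_add hv0]
    have e1 : γ * (β - θ) + γ * (θ - β) = 0 := by ring
    rw [e1, Real.rpow_zero, one_mul, sub_add_cancel]
  rw [h2]
  gcongr

/-- A crude form of Young's inequality for three factors. -/
lemma rpow_mul_mul_le_sq_add_sq_add {a b W q : ℝ} (ha : 0 ≤ a) (hb : 0 ≤ b) (hW : 0 ≤ W)
    (hq1 : 1 ≤ q) (hq2 : q < 2) :
    a ^ (q - 1) * b * W ≤ a ^ 2 + b ^ 2 + W ^ (2 / (2 - q)) := by
  have h2q : 0 < 2 - q := by linarith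
  -- With `W = c ^ (2 - q)` the exponents `q - 1`, `1`, `2 - q` add up to `2`, so the product is at
  -- most the square of the largest of `a`, `b`, `c`.
  set c := W ^ (1 / (2 - q)) with hc
  have hc0 : 0 ≤ c := by positivity
  have hcW : c ^ (2 - q) = W := by
    rw [hc, ← Real.rpow_mul hW, one_div_mul_cancel h2q.ne', Real.rpow_one]
  have hc2 : c ^ 2 = W ^ (2 / (2 - q)) := by
    rw [hc, ← Real.rpow_natCast, ← Real.rpow_mul hW]; congr 1; push_cast; ring
  set m := max (max a b) c with hm
  have ham : a ≤ m := (le_max_left _ _).trans (le_max_left _ _)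
  have hbm : b ≤ m := (le_max_right _ _).trans (le_max_left _ _)
  have hcm : c ≤ m := le_max_right _ _
  have hm0 : 0 ≤ m := ha.trans ham
  calc a ^ (q - 1) * b * W = a ^ (q - 1) * b * c ^ (2 - q) := by rw [hcW]
    _ ≤ m ^ (q - 1) * m * m ^ (2 - q) := by
        have h1 := Real.rpow_le_rpow ha ham (by linarith : 0 ≤ q - 1)
        have h2 := Real.rpow_le_rpow hc0 hcm h2q.le
        gcongr
    _ = m ^ 2 := by
        rw [mul_right_comm, ← Real.rpow_add_of_nonneg hm0 (by linarith) h2q.le]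
        have : q - 1 + (2 - q) = 1 := by ring
        rw [this, Real.rpow_one]; ring
    _ ≤ _ := by
        rw [← hc2]
        rcases max_choice (max a b) c with h | h <;> rcases max_choice a b with h' | h' <;>
          rw [hm, h] <;> (try rw [h']) <;> nlinarith [sq_nonneg a, sq_nonneg b, sq_nonneg c]

/-- The pointwise bound of the nonlinearity for `q < 2`. -/
lemma weight_mul_le_of_lt_two {κ L lam r R v a b α β γ q δ : ℝ} (hL : 0 ≤ L) (hlam : 0 < lam)
    (hR : 0 < R) (hRr : R ≤ r) (hκ : κ ≤ L * (r ^ α * v ^ β)) (hv : lam ≤ r ^ γ * v)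
    (ha : 0 ≤ a) (hb : 0 ≤ b) (hq1 : 1 ≤ q) (hq2 : q < 2) (hβ : β ≤ q / 2) (hδ : 0 ≤ δ) :
    κ * a ^ (q - 1) * b ≤ L * lam ^ (β - q / 2) * R ^ (-δ) *
      (v * a ^ 2 + v * b ^ 2 + r ^ ((α + γ * (q / 2 - β) + δ) * (2 / (2 - q)))) := by
  have hr : 0 < r := hR.trans_le hRr
  have hv0 : 0 < v := pos_of_mul_pos_right (hlam.trans_le hv) (by positivity)
  set e := α + γ * (q / 2 - β) with he
  have h1 := rpow_le_rpow_mul_of_le hr hlam hv hβ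
  have hY := rpow_mul_mul_le_sq_add_sq_add (a := √v * a) (b := √v * b) (W := r ^ (e + δ))
    (by positivity) (by positivity) (by positivity) hq1 hq2
  rw [mul_pow, mul_pow, Real.sq_sqrt hv0.le, ← Real.rpow_mul hr.le] at hY
  have hRδ : r ^ (-δ) ≤ R ^ (-δ) := Real.rpow_le_rpow_of_nonpos hR hRr (by linarith)
  have hvq : (√v) ^ (q - 1) * √v = v ^ (q / 2) := by
    rw [← Real.rpow_add_one (Real.sqrt_pos.2 hv0).ne', sub_add_cancel, Real.sqrt_eq_rpow,
      ← Real.rpow_mul hv0.le]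
    congr 1; ring
  have hre : r ^ α * r ^ (γ * (q / 2 - β)) = r ^ (-δ) * r ^ (e + δ) := by
    rw [← Real.rpow_add hr, ← Real.rpow_add hr]; congr 1; rw [he]; ring
  have hlq : 0 < lam ^ (β - q / 2) := Real.rpow_pos_of_pos hlam _
  calc κ * a ^ (q - 1) * b
      ≤ (L * (r ^ α * (lam ^ (β - q / 2) * r ^ (γ * (q / 2 - β)) * v ^ (q / 2)))) *
          a ^ (q - 1) * b := by
        gcongr
        refine hκ.trans ?_
        gcongr
    _ = L * lam ^ (β - q / 2) * (r ^ α * r ^ (γ * (q / 2 - β))) * v ^ (q / 2) *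
          a ^ (q - 1) * b := by ring
    _ = L * lam ^ (β - q / 2) * r ^ (-δ) *
          ((√v * a) ^ (q - 1) * (√v * b) * r ^ (e + δ)) := by
        rw [hre, ← hvq, Real.mul_rpow (Real.sqrt_nonneg v) ha]; ring
    _ ≤ L * lam ^ (β - q / 2) * R ^ (-δ) * _ := by
        gcongr

/-- The pointwise bound of the nonlinearity for `q ≥ 2`. -/
lemma weight_mul_le_of_two_le {κ L lam r R v a b α β γ q C ν : ℝ} (hL : 0 ≤ L) (hlam : 0 < lam)
    (hC : 0 ≤ C) (hR : 0 < R) (hRr : R ≤ r) (hκ : κ ≤ L * (r ^ α * v ^ β))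
    (hv : lam ≤ r ^ γ * v) (ha : 0 ≤ a) (hb : 0 ≤ b) (haC : a ≤ C * r ^ (-ν)) (hq : 2 ≤ q)
    (hβ : β ≤ 1) (he : α + γ * (1 - β) - ν * (q - 2) ≤ 0) :
    κ * a ^ (q - 1) * b ≤ L * lam ^ (β - 1) * C ^ (q - 2) *
      R ^ (α + γ * (1 - β) - ν * (q - 2)) * (v * a ^ 2 + v * b ^ 2) := by
  have hr : 0 < r := hR.trans_le hRr
  have hv0 : 0 < v := pos_of_mul_pos_right (hlam.trans_le hv) (by positivity)
  set e := α + γ * (1 - β) - ν * (q - 2) with hedef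
  have h1 := rpow_le_rpow_mul_of_le hr hlam hv hβ
  rw [Real.rpow_one] at h1
  have hRe : r ^ e ≤ R ^ e := Real.rpow_le_rpow_of_nonpos hR hRr he
  have haq : a ^ (q - 1) ≤ C ^ (q - 2) * r ^ (-ν * (q - 2)) * a := by
    have h2 : a ^ (q - 1) = a ^ (q - 2) * a := by
      have h3 : q - 1 = (q - 2) + 1 := by ring
      rw [h3, Real.rpow_add_of_nonneg ha (by linarith) zero_le_one, Real.rpow_one]
    rw [h2, Real.rpow_mul hr.le, ← Real.mul_rpow hC (by positivity)]
    gcongr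
  have hre : r ^ α * r ^ (γ * (1 - β)) * r ^ (-ν * (q - 2)) = r ^ e := by
    rw [← Real.rpow_add hr, ← Real.rpow_add hr]; congr 1; rw [hedef]; ring
  have hlq : 0 < lam ^ (β - 1) := Real.rpow_pos_of_pos hlam _
  have hab : a * b ≤ a ^ 2 + b ^ 2 := by nlinarith [sq_nonneg (a - b), sq_nonneg a, sq_nonneg b]
  calc κ * a ^ (q - 1) * b
      ≤ (L * (r ^ α * (lam ^ (β - 1) * r ^ (γ * (1 - β)) * v))) *
          (C ^ (q - 2) * r ^ (-ν * (q - 2)) * a) * b := by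
        gcongr
        refine hκ.trans ?_
        gcongr
    _ = L * lam ^ (β - 1) * C ^ (q - 2) *
          (r ^ α * r ^ (γ * (1 - β)) * r ^ (-ν * (q - 2))) * (v * (a * b)) := by ring
    _ ≤ L * lam ^ (β - 1) * C ^ (q - 2) * R ^ e * (v * (a ^ 2 + b ^ 2)) := by
        rw [hre]; gcongr
    _ = _ := by ring

lemma ofReal_mul_abs_sq {V : ℝ≥0∞} (hV : V ≠ ∞) (y : ℝ) :
    ENNReal.ofReal (V.toReal * |y| ^ 2) = V * ‖y‖ₑ ^ 2 := by
  rw [ENNReal.ofReal_mul ENNReal.toReal_nonneg, ENNReal.ofReal_toReal hV,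
    ENNReal.ofReal_pow (abs_nonneg _), ← Real.norm_eq_abs, ofReal_norm]

end Bilaplacian

end

/-! ### The theorem -/

theorem theorem4 (N : ℕ) (hN : 5 ≤ N) (V : ℝ → ℝ≥0∞) (K : ℝ → ℝ)
    (hV : Bilaplacian.CondV V) (hK : Bilaplacian.CondK K)
    (R₂ : ℝ) (hR₂ : 0 < R₂)
    (hVfin : ∀ᵐ r ∂(volume.restrict (Ioi R₂)), V r < ∞)
    (α β γ : ℝ) (hβ₀ : 0 ≤ β) (hβ₁ : β ≤ 1)
    (hsup : essSup (fun r : ℝ => ENNReal.ofReal (K r) / (ENNReal.ofReal (r ^ α) * V r ^ β))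
      (volume.restrict (Ioi R₂)) < ∞)
    (hγ : γ ≤ 4)
    (hinf : 0 < essInf (fun r : ℝ => ENNReal.ofReal (r ^ γ) * V r)
      (volume.restrict (Ioi R₂)))
    (q₂ : ℝ)
    (hq₂ : max (max 1 (2 * β))
      (max (Bilaplacian.qStar N α β γ) (Bilaplacian.qStarStar N α β γ)) < q₂) :
    Tendsto (fun R : ℝ => Bilaplacian.RInf N V K q₂ R) atTop (𝓝 0) := by
  have hN0 : 0 < N := by omega
  have hN' : (5 : ℝ) ≤ N := by exact_mod_cast hN
  simp only [max_lt_iff] at hq₂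
  obtain ⟨⟨hq1, hqβ⟩, hqs, hqss⟩ := hq₂
  -- The essential infimum may be `∞`; a value strictly below it is a usable real constant.
  obtain ⟨lam', hlam'0, hlam'⟩ := exists_between hinf
  have hlam'top : lam' ≠ ∞ := ne_top_of_lt hlam'
  set lam := lam'.toReal with hlamdef
  have hlam : 0 < lam := ENNReal.toReal_pos hlam'0.ne' hlam'top
  have hlamV : ∀ᵐ r, R₂ < r → ENNReal.ofReal lam ≤ ENNReal.ofReal (r ^ γ) * V r := by
    refine (ae_restrict_iff' measurableSet_Ioi).1 ?_
    filter_upwards [ae_essInf_le (f := fun r : ℝ => ENNReal.ofReal (r ^ γ) * V r)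
      (μ := volume.restrict (Ioi R₂))] with r hr
    rw [hlamdef, ENNReal.ofReal_toReal hlam'top]
    exact hlam'.le.trans hr
  obtain ⟨C, hC, hdecay⟩ := Bilaplacian.exists_pointwise_bound hN hγ hlam hlamV
  set L := (essSup (fun r : ℝ => ENNReal.ofReal (K r) / (ENNReal.ofReal (r ^ α) * V r ^ β))
      (volume.restrict (Ioi R₂))).toReal with hLdef
  have hL : 0 ≤ L := ENNReal.toReal_nonneg
  have hreal : ∀ᵐ r, R₂ < r →
      V r ≠ ∞ ∧ lam ≤ r ^ γ * (V r).toReal ∧ K r ≤ L * (r ^ α * (V r).toReal ^ β) := by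
    have h1 := (ae_restrict_iff' measurableSet_Ioi).1 (ENNReal.ae_le_essSup
      (fun r : ℝ => ENNReal.ofReal (K r) / (ENNReal.ofReal (r ^ α) * V r ^ β))
      (μ := volume.restrict (Ioi R₂)))
    have h2 := (ae_restrict_iff' measurableSet_Ioi).1 hVfin
    filter_upwards [h1, h2, hlamV] with r h1 h2 h3 hr
    have hr0 : 0 < r := hR₂.trans hr
    have hVr := (h2 hr).ne
    have hv : lam ≤ r ^ γ * (V r).toReal := by
      have h4 := h3 hr
      rw [← ENNReal.ofReal_toReal hVr, ← ENNReal.ofReal_mul (by positivity),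
        ENNReal.ofReal_le_ofReal_iff (by positivity)] at h4
      exact h4
    refine ⟨hVr, hv, ?_⟩
    -- Here `0 < V r < ∞`, so the quotient in `hsup` is a genuine real quotient, free of conventions
    -- for `0` and `∞`.
    have hv0 : 0 < (V r).toReal := pos_of_mul_pos_right (hlam.trans_le hv) (by positivity)
    have h5 := h1 hr
    rw [← ENNReal.ofReal_toReal hsup.ne, ← hLdef, ← ENNReal.ofReal_toReal hVr,
      ENNReal.ofReal_rpow_of_pos hv0, ← ENNReal.ofReal_mul (by positivity),
      ← ENNReal.ofReal_div_of_pos (by positivity), ENNReal.ofReal_le_ofReal_iff hL,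
      div_le_iff₀ (by positivity)] at h5
    exact h5
  have hrealx := Bilaplacian.ae_norm hN0 (hreal.mono fun r hr (_ : 0 < r) => hr)
  rcases lt_or_ge q₂ 2 with hq2 | hq2
  · have hes : α + γ * (q₂ / 2 - β) + N * (2 - q₂) / 2 < 0 := by
      unfold Bilaplacian.qStar at hqs
      rw [mul_div_assoc', div_lt_iff₀ (by linarith)] at hqs
      linarith
    set e := α + γ * (q₂ / 2 - β) with he
    -- Half of the slack in `q_* < q₂`: one half gives the factor `R ^ (-δ)`, the other keeps `‖x‖ ^
    -- p` integrable at infinity.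
    set δ := -(e + N * (2 - q₂) / 2) / 2 with hδ
    have hδ0 : 0 < δ := by rw [hδ]; linarith
    set p := (e + δ) * (2 / (2 - q₂)) with hp
    have h2q : 0 < 2 - q₂ := by linarith
    have hpN : (N : ℝ) < -p := by
      rw [hp, ← neg_mul, mul_div_assoc', lt_div_iff₀ h2q]
      linarith
    refine Bilaplacian.tendsto_RInf_of_pointwise_le hN0 hV (R₀ := max 1 R₂)
      -- The bound `‖x‖ ≥ (1 + ‖x‖) / 2` for `‖x‖ ≥ 1` replaces `‖x‖ ^ p` by a function integrable
      -- near the origin as well.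
      (G := fun x => ENNReal.ofReal (2 ^ (-p)) * ENNReal.ofReal ((1 + ‖x‖) ^ (-(-p))))
      (ε := fun R => L * lam ^ (β - q₂ / 2) * R ^ (-δ)) ?_ ?_ ?_
    · rw [lintegral_const_mul' _ _ ENNReal.ofReal_ne_top]
      exact ENNReal.mul_lt_top ENNReal.ofReal_lt_top
        (finite_integral_one_add_norm (by rwa [finrank_euclideanSpace, Fintype.card_fin]))
    · simpa using (tendsto_rpow_neg_atTop hδ0).const_mul (L * lam ^ (β - q₂ / 2))
    · intro u h _ _ _ _
      filter_upwards [hrealx] with x hx R hR hRx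
      have hR1 : 1 < R := (le_max_left _ _).trans_lt hR
      obtain ⟨hVx, hv, hκ⟩ := hx (((le_max_right _ _).trans_lt hR).trans_le hRx)
      have hx0 : 0 < ‖x‖ := by linarith
      have hb := Bilaplacian.weight_mul_le_of_lt_two hL hlam (zero_lt_one.trans hR1) hRx hκ hv
        (abs_nonneg (u x)) (abs_nonneg (h x)) hq1.le hq2 (by linarith) hδ0.le
      refine (ENNReal.ofReal_le_ofReal hb).trans ?_
      rw [ENNReal.ofReal_mul (by positivity), ENNReal.ofReal_add (by positivity) (by positivity),
        ENNReal.ofReal_add (by positivity) (by positivity), Bilaplacian.ofReal_mul_abs_sq hVx,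
        Bilaplacian.ofReal_mul_abs_sq hVx]
      gcongr
      rw [← ENNReal.ofReal_mul (by positivity)]
      refine ENNReal.ofReal_le_ofReal ?_
      rw [neg_neg, ← he, ← hp]
      calc ‖x‖ ^ p ≤ (2⁻¹ * (1 + ‖x‖)) ^ p :=
            Real.rpow_le_rpow_of_nonpos (by positivity) (by linarith) (by linarith)
        _ = 2 ^ (-p) * (1 + ‖x‖) ^ p := by
            rw [Real.mul_rpow (by norm_num) (by positivity), Real.inv_rpow (by norm_num),
              Real.rpow_neg (by norm_num)]
  · set ν := (2 * ((N : ℝ) - 2) - γ) / 4 with hν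
    -- This is `q_** < q₂` cleared of its denominator, positive since `N ≥ 5` and `γ ≤ 4`.
    have hess : α + γ * (1 - β) - ν * (q₂ - 2) < 0 := by
      unfold Bilaplacian.qStarStar at hqss
      rw [mul_div_assoc', div_lt_iff₀ (by linarith)] at hqss
      rw [hν]
      linarith
    set e := α + γ * (1 - β) - ν * (q₂ - 2) with he
    refine Bilaplacian.tendsto_RInf_of_pointwise_le hN0 hV (R₀ := max 1 R₂) (G := fun _ => 0)
      (ε := fun R => L * lam ^ (β - 1) * C ^ (q₂ - 2) * R ^ e) (by simp) ?_ ?_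
    · have h := (tendsto_rpow_neg_atTop (y := -e) (by linarith)).const_mul
        (L * lam ^ (β - 1) * C ^ (q₂ - 2))
      simpa using h
    · intro u h hu _ hu1 _
      filter_upwards [hrealx, hdecay u hu hu1] with x hx hxu R hR hRx
      have hR1 : 1 < R := (le_max_left _ _).trans_lt hR
      obtain ⟨hVx, hv, hκ⟩ := hx (((le_max_right _ _).trans_lt hR).trans_le hRx)
      have hb := Bilaplacian.weight_mul_le_of_two_le hL hlam hC.le (zero_lt_one.trans hR1) hRx hκ hv
        (abs_nonneg (u x)) (abs_nonneg (h x)) (hxu (hR.trans_le hRx)) hq2 hβ₁ hess.le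
      refine (ENNReal.ofReal_le_ofReal hb).trans ?_
      rw [ENNReal.ofReal_mul (by positivity), ENNReal.ofReal_add (by positivity) (by positivity),
        Bilaplacian.ofReal_mul_abs_sq hVx, Bilaplacian.ofReal_mul_abs_sq hVx, add_zero]
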